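/- All objects are holomorphic. An F-manifold $(N,\circ,e)$ (without Euler field) is a complex manifold $N$ of dimension $n$ with a fibrewise commutative, associative, $\mathbb{C}$-bilinear multiplication $\circ$ on $TN$ with unit field $e$ such that $L_{X\circ Y}(\circ)=X\circ L_Y(\circ)+Y\circ L_X(\circ)$ for all local vector fields $X,Y$. It is \emph{constant} if it has a (global) coordinate system $t=(t^i)$, called canonical, in which the structure constants $c_{ij}^k$, $\partial_i\circ\partial_j=c_{ij}^k\partial_k$, are constant. A metric is a non-degenerate symmetric complex bilinear form on $TN$; it is (multiplication) invariant if $g(X\circ Y,Z)=g(X,Y\circ Z)$. A metric $g$ is \emph{Frobenius} on $(N,\circ,e)$ if it is flat and invariant and $\nabla^{\mathrm{LC}}e=0$ for its Levi-Civita connection. Let $(N,\circ,e)$ be a connected constant F-manifold with canonical coordinates $(t^i)$, and let $\epsilon=\epsilon_{ij}\,dt^i\otimes dt^j$ be an invariant metric with constant coefficients $\epsilon_{ij}$. Let $\epsilon^{-1}:T^*N\to TN$ be the isomorphism defined by $\epsilon$, and transport by it the multiplication $\circ$ and the metric $\epsilon$ to $T^*N$, so that $\epsilon(\varphi,\psi)=\epsilon^{ij}\varphi_i\psi_j$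 with $(\epsilon^{ij})=(\epsilon_{ij})^{-1}$. Let $\psi=\psi_j\,dt^j$ be a 1-form that is invertible with respect to $\circ$ at every point, let $T=\epsilon^{-1}(\psi)$, and let $T^{-1}$ be the inverse of $T$ with respect to $\circ$. Write $\mathcal{C}_i(X)=\partial_i\circ X$. Then the metric $$g(X,Y):=(\psi\circ\psi)(X\circ Y)$$ is Frobenius on $(N,\circ,e)$ if and only if $\epsilon(\psi,\psi)$ is constant and the endomorphism $$\gamma=\sum_i L_{\epsilon^{-1}(dt^i)}(\psi)\otimes(\partial_i\circ T^{-1})$$ of $TN$ is $\epsilon$-symmetric and satisfies the generalized Darboux--Egoroff equations $$[\mathcal{C}_i,L_{\partial_j}(\gamma)]-[\mathcal{C}_j,L_{\partial_i}(\gamma)]-[[\mathcal{C}_i,\gamma],[\mathcal{C}_j,\gamma]]=0\qquad\text{for all } i,j.$$ -/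

import Mathlib

open scoped Manifold ContDiff

noncomputable section

namespace ConstantFManifold

/-! ### Complex manifolds, vector fields, tensor fields

`N` is a complex manifold of dimension `n`, modelled on `ℂⁿ = Fin n → ℂ`. -/

/-- The holomorphic tangent space `T_p N`. -/
abbrev Tan (n : ℕ) {N : Type*} [TopologicalSpace N] [ChartedSpace (Fin n → ℂ) N] (p : N) : Type :=
  TangentSpace 𝓘(ℂ, Fin n → ℂ) p

/-- (Not necessarily holomorphic) vector fields. -/
abbrev VField (n : ℕ) (N : Type*) [TopologicalSpace N] [ChartedSpace (Fin n → ℂ) N] :=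
  ∀ p : N, Tan n p

/-- Fields of covectors. -/
abbrev OneForm (n : ℕ) (N : Type*) [TopologicalSpace N] [ChartedSpace (Fin n → ℂ) N] :=
  ∀ p : N, Tan n p →ₗ[ℂ] ℂ

/-- Fields of endomorphisms of the tangent spaces. -/
abbrev EndField (n : ℕ) (N : Type*) [TopologicalSpace N] [ChartedSpace (Fin n → ℂ) N] :=
  ∀ p : N, Module.End ℂ (Tan n p)

/-- Fields of complex bilinear forms on the tangent spaces. -/
abbrev BilinField (n : ℕ) (N : Type*) [TopologicalSpace N] [ChartedSpace (Fin n → ℂ) N] :=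
  ∀ p : N, Tan n p →ₗ[ℂ] Tan n p →ₗ[ℂ] ℂ

section Basic

variable {n : ℕ} {N : Type*} [TopologicalSpace N] [ChartedSpace (Fin n → ℂ) N]
  [IsManifold 𝓘(ℂ, Fin n → ℂ) ω N]

/-- The vector field `X` is holomorphic (near) `p`. -/
def HolAt (X : VField n N) (p : N) : Prop :=
  ContMDiffAt 𝓘(ℂ, Fin n → ℂ) 𝓘(ℂ, Fin n → ℂ).tangent ω
    (fun q => (⟨q, X q⟩ : TangentBundle 𝓘(ℂ, Fin n → ℂ) N)) p

/-- The Lie bracket `[X, Y]` of vector fields. -/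
def bracket (X Y : VField n N) : VField n N :=
  VectorField.mlieBracket 𝓘(ℂ, Fin n → ℂ) X Y

/-- The Lie derivative of a multiplication `∘` on `TN`:
`L_X(∘)(Z, W) = [X, Z ∘ W] - [X, Z] ∘ W - Z ∘ [X, W]`. -/
def lieMul (mul : ∀ p : N, Tan n p →ₗ[ℂ] Tan n p →ₗ[ℂ] Tan n p) (X Z W : VField n N) :
    VField n N :=
  fun p => bracket X (fun q => mul q (Z q) (W q)) p
    - mul p (bracket X Z p) (W p) - mul p (Z p) (bracket X W p)

end Basic

/-- An F-manifold structure (without Euler field) on the complex manifold `N`: a holomorphic,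
fibrewise commutative and associative multiplication on `TN` with unit field `e` such that
`L_{X ∘ Y}(∘) = X ∘ L_Y(∘) + Y ∘ L_X(∘)` for all (local) holomorphic vector fields. -/
structure FManifold (n : ℕ) (N : Type*) [TopologicalSpace N] [ChartedSpace (Fin n → ℂ) N]
    [IsManifold 𝓘(ℂ, Fin n → ℂ) ω N] where
  mul : ∀ p : N, Tan n p →ₗ[ℂ] Tan n p →ₗ[ℂ] Tan n p
  e : VField n N
  mul_comm : ∀ p u v, mul p u v = mul p v u
  mul_assoc : ∀ p u v w, mul p (mul p u v) w = mul p u (mul p v w)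
  e_mul : ∀ p v, mul p (e p) v = v
  hol_mul : ∀ (p : N) (X Y : VField n N), HolAt X p → HolAt Y p →
    HolAt (fun q => mul q (X q) (Y q)) p
  hol_e : ∀ p : N, HolAt e p
  integrable : ∀ (p : N) (X Y Z W : VField n N),
    HolAt X p → HolAt Y p → HolAt Z p → HolAt W p →
    lieMul mul (fun q => mul q (X q) (Y q)) Z W p
      = mul p (X p) (lieMul mul Y Z W p) + mul p (Y p) (lieMul mul X Z W p)

section Coordinates

variable {n : ℕ} {N : Type*} [TopologicalSpace N] [ChartedSpace (Fin n → ℂ) N]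
  [IsManifold 𝓘(ℂ, Fin n → ℂ) ω N]

/-- `t = (t⁰, …, tⁿ⁻¹)` is a (global) holomorphic coordinate system on `N`. -/
structure IsCoordSystem (t : OpenPartialHomeomorph N (Fin n → ℂ)) : Prop where
  mem_atlas : t ∈ IsManifold.maximalAtlas 𝓘(ℂ, Fin n → ℂ) ω N
  source_eq : t.source = Set.univ

/-- The differential `dtⁱ` of the `i`-th coordinate. -/
def dt (t : OpenPartialHomeomorph N (Fin n → ℂ)) (i : Fin n) : OneForm n N :=
  fun p => (mvfderiv 𝓘(ℂ, Fin n → ℂ) (fun q => t q i) p).toLinearMap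

/-- The coordinate vector field `∂_i = ∂/∂tⁱ`. -/
def coordField (t : OpenPartialHomeomorph N (Fin n → ℂ)) (i : Fin n) : VField n N :=
  VectorField.mpullback 𝓘(ℂ, Fin n → ℂ) 𝓘(ℂ, Fin n → ℂ) t (fun _ => Pi.single i (1 : ℂ))

/-- The partial derivative `∂_i f = ∂f/∂tⁱ` of a function `f`. -/
def pd (t : OpenPartialHomeomorph N (Fin n → ℂ)) (i : Fin n) (f : N → ℂ) : N → ℂ :=
  fun p => fderiv ℂ (fun x => f (t.symm x)) (t p) (Pi.single i (1 : ℂ))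

/-- The matrix `(g_ij)` of a bilinear form in the coordinates `t`. -/
def gram (t : OpenPartialHomeomorph N (Fin n → ℂ)) (g : BilinField n N) (p : N) :
    Matrix (Fin n) (Fin n) ℂ :=
  Matrix.of fun i j => g p (coordField t i p) (coordField t j p)

/-- The 1-form `ψ = ψ_j dtʲ` is holomorphic. -/
def HolForm (t : OpenPartialHomeomorph N (Fin n → ℂ)) (ψ : OneForm n N) : Prop :=
  ∀ j, MDifferentiable 𝓘(ℂ, Fin n → ℂ) 𝓘(ℂ, ℂ) (fun p => ψ p (coordField t j p))

/-- A (holomorphic, complex bilinear, symmetric, non-degenerate) metric on `N`. -/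
structure IsMetric (t : OpenPartialHomeomorph N (Fin n → ℂ)) (g : BilinField n N) : Prop where
  symm : ∀ p u v, g p u v = g p v u
  nondegenerate : ∀ p u, (∀ v, g p u v = 0) → u = 0
  holomorphic : ∀ i j, MDifferentiable 𝓘(ℂ, Fin n → ℂ) 𝓘(ℂ, ℂ) (fun p => gram t g p i j)

/-- Multiplication invariance: `g(X ∘ Y, Z) = g(X, Y ∘ Z)`. -/
def IsInvariant (F : FManifold n N) (g : BilinField n N) : Prop :=
  ∀ p u v w, g p (F.mul p u v) w = g p u (F.mul p v w)

/-- `t` is a canonical coordinate system: `∂_i ∘ ∂_j = c_ij^k ∂_k` with constant `c_ij^k`. An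
F-manifold is constant if it has a canonical coordinate system. -/
structure IsCanonical (F : FManifold n N) (t : OpenPartialHomeomorph N (Fin n → ℂ)) : Prop where
  isCoordSystem : IsCoordSystem t
  mul_const : ∃ c : Fin n → Fin n → Fin n → ℂ, ∀ p i j,
    F.mul p (coordField t i p) (coordField t j p) = ∑ k, c i j k • coordField t k p

/-- The bilinear form `ε` has constant coefficients in the coordinates `t`. -/
def HasConstCoeffs (t : OpenPartialHomeomorph N (Fin n → ℂ)) (ε : BilinField n N) : Prop :=
  ∃ a : Matrix (Fin n) (Fin n) ℂ, ∀ p, gram t ε p = a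

/-! ### Lie derivatives, in coordinates -/

/-- The Lie derivative of a 1-form:
`(L_X ψ)_j = X^k ∂_k ψ_j + ψ_k ∂_j X^k`. -/
def lieForm (t : OpenPartialHomeomorph N (Fin n → ℂ)) (X : VField n N) (ψ : OneForm n N) :
    OneForm n N :=
  fun p => ∑ j, (∑ k, (dt t k p (X p) * pd t k (fun q => ψ q (coordField t j q)) p
    + ψ p (coordField t k p) * pd t j (fun q => dt t k q (X q)) p)) • dt t j p

/-- The Lie derivative of an endomorphism `A = A^a_b dt^b ⊗ ∂_a` of `TN`:
`(L_X A)^a_b = X^k ∂_k A^a_b - A^k_b ∂_k X^a + A^a_k ∂_b X^k`. -/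
def lieEnd (t : OpenPartialHomeomorph N (Fin n → ℂ)) (X : VField n N) (A : EndField n N) :
    EndField n N :=
  fun p => ∑ a, ∑ b,
    (∑ k, (dt t k p (X p) * pd t k (fun q => dt t a q (A q (coordField t b q))) p
      - dt t k p (A p (coordField t b p)) * pd t k (fun q => dt t a q (X q)) p
      + dt t a p (A p (coordField t k p)) * pd t b (fun q => dt t k q (X q)) p)) •
    (dt t b p).smulRight (coordField t a p)

/-! ### Levi-Civita connection and curvature, in coordinates -/

/-- Christoffel symbols `Γ^k_ij = ½ g^kl (∂_i g_jl + ∂_j g_il - ∂_l g_ij)` of the Levi-Civita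
connection of `g`. -/
def christoffel (t : OpenPartialHomeomorph N (Fin n → ℂ)) (g : BilinField n N)
    (k i j : Fin n) (p : N) : ℂ :=
  (1 / 2 : ℂ) * ∑ l, (gram t g p)⁻¹ k l *
    (pd t i (fun q => gram t g q j l) p + pd t j (fun q => gram t g q i l) p
      - pd t l (fun q => gram t g q i j) p)

/-- The curvature `R(∂_i, ∂_j)∂_k = R^l_kij ∂_l` of the Levi-Civita connection of `g`. -/
def curvature (t : OpenPartialHomeomorph N (Fin n → ℂ)) (g : BilinField n N)
    (l k i j : Fin n) (p : N) : ℂ :=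
  pd t i (christoffel t g l j k) p - pd t j (christoffel t g l i k) p
    + ∑ m, (christoffel t g l i m p * christoffel t g m j k p
      - christoffel t g l j m p * christoffel t g m i k p)

/-- `g` is a Frobenius metric on the F-manifold `(N, ∘, e)` without Euler field: a flat,
multiplication invariant metric whose Levi-Civita connection satisfies `∇ e = 0`. (Flatness and
`∇ e = 0` are tensorial, so they do not depend on the coordinates used to express them.) -/
structure IsFrobenius (F : FManifold n N) (t : OpenPartialHomeomorph N (Fin n → ℂ))
    (g : BilinField n N) : Prop where
  metric : IsMetric t g
  invariant : IsInvariant F g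
  flat : ∀ p l k i j, curvature t g l k i j p = 0
  unit_flat : ∀ p i k, pd t i (fun q => dt t k q (F.e q)) p
    + ∑ j, christoffel t g k i j p * dt t j p (F.e p) = 0

/-! ### Operations on 1-forms induced by `ε` -/

/-- The isomorphism `ε⁻¹ : T*N → TN`, `ε⁻¹(ψ) = ε^ij ψ_j ∂_i`. -/
def sharp (t : OpenPartialHomeomorph N (Fin n → ℂ)) (ε : BilinField n N) (ψ : OneForm n N) :
    VField n N :=
  fun p => ∑ i, (∑ j, (gram t ε p)⁻¹ i j * ψ p (coordField t j p)) • coordField t i p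

/-- The multiplication on `T*N` transported from `TN` by `ε`. -/
def formMul (F : FManifold n N) (t : OpenPartialHomeomorph N (Fin n → ℂ)) (ε : BilinField n N)
    (φ ψ : OneForm n N) : OneForm n N :=
  fun p => ε p (F.mul p (sharp t ε φ p) (sharp t ε ψ p))

/-- The 1-form `ψ` is invertible: at every point the covector `ψ_p` is invertible for the
multiplication of covectors, whose unit is `ε(e, ·)`. -/
def IsInvertibleForm (F : FManifold n N) (t : OpenPartialHomeomorph N (Fin n → ℂ))
    (ε : BilinField n N) (ψ : OneForm n N) : Prop :=
  ∃ β : OneForm n N, ∀ p, formMul F t ε ψ β p = ε p (F.e p)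

/-- The metric induced by `ε` on `T*N`: `ε(φ, ψ) = ε^ij φ_i ψ_j`. -/
def formMetric (t : OpenPartialHomeomorph N (Fin n → ℂ)) (ε : BilinField n N)
    (φ ψ : OneForm n N) (p : N) : ℂ :=
  ∑ i, ∑ j, (gram t ε p)⁻¹ i j * φ p (coordField t i p) * ψ p (coordField t j p)

open Classical in
/-- The inverse `T⁻¹` of a vector field with respect to `∘` (zero where `T` is not invertible). -/
def vinv (F : FManifold n N) (T : VField n N) : VField n N :=
  fun p => if h : ∃ S : Tan n p, F.mul p (T p) S = F.e p then h.choose else 0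

/-- The bilinear form `g(X, Y) = (ψ ∘ ψ)(X ∘ Y)`. -/
def psiMetric (F : FManifold n N) (t : OpenPartialHomeomorph N (Fin n → ℂ)) (ε : BilinField n N)
    (ψ : OneForm n N) : BilinField n N :=
  fun p => (F.mul p).compr₂ (formMul F t ε ψ ψ p)

/-- The endomorphism `γ = ∑_i L_{ε⁻¹(dtⁱ)}(ψ) ⊗ (∂_i ∘ T⁻¹)`, where `T = ε⁻¹(ψ)`. -/
def rotationOp (F : FManifold n N) (t : OpenPartialHomeomorph N (Fin n → ℂ)) (ε : BilinField n N)
    (ψ : OneForm n N) : EndField n N :=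
  fun p => ∑ i, (lieForm t (sharp t ε (dt t i)) ψ p).smulRight
    (F.mul p (coordField t i p) (vinv F (sharp t ε ψ) p))

/-- `A` is symmetric with respect to `ε`. -/
def IsSymmEnd (ε : BilinField n N) (A : EndField n N) : Prop :=
  ∀ p u v, ε p (A p u) v = ε p u (A p v)

/-- The operator `C_i` of multiplication by `∂_i`. -/
def multOp (F : FManifold n N) (t : OpenPartialHomeomorph N (Fin n → ℂ)) (i : Fin n) :
    EndField n N :=
  fun p => F.mul p (coordField t i p)

/-- The generalized Darboux-Egoroff equations
`[C_i, L_{∂_j}(γ)] - [C_j, L_{∂_i}(γ)] = [[C_i, γ], [C_j, γ]]`. -/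
def DarbouxEgoroff (F : FManifold n N) (t : OpenPartialHomeomorph N (Fin n → ℂ))
    (γ : EndField n N) : Prop :=
  ∀ (p : N) (i j : Fin n),
    ⁅multOp F t i p, lieEnd t (coordField t j) γ p⁆
      - ⁅multOp F t j p, lieEnd t (coordField t i) γ p⁆
      = ⁅⁅multOp F t i p, γ p⁆, ⁅multOp F t j p, γ p⁆⁆

end Coordinates

end ConstantFManifold

end

/-!
The theorem is local linear algebra over the ring of holomorphic functions, once everything is
written in the canonical coordinates. Let `G` be the constant Gram matrix of `ε`, let `C i` be the
constant matrix of multiplication by `∂_i`, let `M = ∑ i, T i • C i` be the matrix of multiplication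
by `T = ε⁻¹(ψ)`, and let `J` be the Jacobian matrix of `T`. Invariance of `ε` says that `G`
intertwines each `C i` with its transpose, so that the metric `g(X, Y) = ε(T ∘ X, T ∘ Y)` has Gram
matrix `G M M`, and `γ` has matrix `M⁻¹ G⁻¹ Jᵀ G`. Three facts give the result.

* `∇ e = 0`. By the Koszul formula `2 g(∇_X e, Y) = dη(X, Y) + e (η (X ∘ Y))` for constant `X`, `Y`,
  where `η = ψ ∘ ψ = ε(T ∘ T, ·)`. The antisymmetric part vanishes when `η` is closed; then the
  symmetric part vanishes when the derivatives of `η(e) = ε(ψ, ψ)` do. Since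
  `∂_i η_l = 2 (G M J)_li`, the form `η` is closed exactly when `γ` is symmetric
  (`InvariantAlgebra.koszul_unit_iff`, `InvariantAlgebra.rotation_symm_iff`).
* The Levi-Civita connection. If `γ` is symmetric, then `J = γ M`, and the matrices
  `P_j = M⁻¹ (∂_j M + [C_j, γ] M)` are torsion free and compatible with `g`: the commutator of two
  symmetric operators is antisymmetric. Hence they are the Christoffel matrices of `g`
  (`InvariantAlgebra.connection_torsion_free`, `InvariantAlgebra.map_derivation_twist`,
  `koszul_unique`).
* Flatness. The connection `P` is the gauge transform by `M` of the connection with matrices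
  `[C_j, γ]`, so its curvature is conjugate to that of the latter, whose vanishing is the system of
  Darboux-Egoroff equations (`mul_curvature_eq`, `InvariantAlgebra.curvature_eq_zero_iff`).

The computations take place in matrices over a commutative ring with commuting derivations. To
apply them to holomorphic functions, one needs that the partial derivatives of a function which is
merely complex differentiable are again complex differentiable and commute; this follows from the
Cauchy integral formula along complex lines (`differentiableAt_fderiv_apply_of_eventually`).
-/

noncomputable section

namespace ConstantFManifold

/-! ### Holomorphic functions of several variables -/

section SeveralVariables

variable {E : Type*} [NormedAddCommGroup E] [NormedSpace ℂ E] [FiniteDimensional ℂ E]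

/-- The directional derivatives of a holomorphic function are holomorphic: along each complex line
they are given by a Cauchy integral, which may be differentiated under the integral sign. -/
theorem differentiableAt_fderiv_apply_of_eventually {f : E → ℂ} {x₀ : E}
    (hf : ∀ᶠ x in nhds x₀, DifferentiableAt ℂ f x) (v : E) :
    DifferentiableAt ℂ (fun x => fderiv ℂ f x v) x₀ := by
  obtain ⟨ρ, hρ, hball⟩ : ∃ ρ > 0, ∀ x ∈ Metric.ball x₀ (4 * ρ),
      DifferentiableAt ℂ f x ∧ ‖f x‖ < ‖f x₀‖ + 1 := by
    have hb : ∀ᶠ x in nhds x₀, ‖f x‖ < ‖f x₀‖ + 1 :=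
      hf.self_of_nhds.continuousAt.norm.eventually_lt continuousAt_const (by simp)
    obtain ⟨δ, hδ, h⟩ := Metric.eventually_nhds_iff_ball.1 (hf.and hb)
    exact ⟨δ / 4, by positivity, fun x hx => h x (by convert hx using 2; ring)⟩
  set K : ℝ := ‖f x₀‖ + 1 with hK
  -- a bound for the derivatives, uniform on the ball of radius `2 * ρ`
  have hbound : ∀ y ∈ Metric.ball x₀ (2 * ρ), ‖fderiv ℂ f y‖ ≤ 2 * K / ρ := by
    intro y hy
    have hsub : ∀ z ∈ Metric.ball y ρ, z ∈ Metric.ball x₀ (4 * ρ) := fun z hz => by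
      rw [Metric.mem_ball] at *
      linarith [dist_triangle z y x₀]
    refine Complex.norm_fderiv_le_div_of_mapsTo_ball
      (fun z hz => (hball z (hsub z hz)).1.differentiableWithinAt) (fun z hz => ?_) hρ
    rw [mem_closedBall_iff_norm]
    have h1 := (hball z (hsub z hz)).2
    have h2 := (hball y (hsub y (Metric.mem_ball_self hρ))).2
    linarith [norm_sub_le (f z) (f y)]
  -- a radius for which the discs `x + z v` stay inside that ball
  obtain ⟨r, hr, hrv⟩ : ∃ r > 0, r * ‖v‖ < ρ := by
    refine ⟨ρ / (‖v‖ + 1), by positivity, ?_⟩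
    rw [div_mul_eq_mul_div, div_lt_iff₀ (by positivity)]
    nlinarith [norm_nonneg v]
  have hmem : ∀ x ∈ Metric.ball x₀ ρ, ∀ z : ℂ, ‖z‖ ≤ r → x + z • v ∈ Metric.ball x₀ (2 * ρ) := by
    intro x hx z hz
    rw [mem_ball_iff_norm] at *
    have : ‖z • v‖ < ρ := by
      rw [norm_smul]
      exact (mul_le_mul_of_nonneg_right hz (norm_nonneg v)).trans_lt hrv
    calc ‖x + z • v - x₀‖ = ‖(x - x₀) + z • v‖ := by congr 1; abel
      _ ≤ ‖x - x₀‖ + ‖z • v‖ := norm_add_le _ _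
      _ < 2 * ρ := by linarith
  have hsub : ∀ y ∈ Metric.ball x₀ (2 * ρ), DifferentiableAt ℂ f y := fun y hy =>
    (hball y (Metric.ball_subset_ball (by linarith) hy)).1
  have hline : ∀ x ∈ Metric.ball x₀ ρ, ∀ z : ℂ, ‖z‖ ≤ r →
      HasDerivAt (fun w : ℂ => f (x + w • v)) (fderiv ℂ f (x + z • v) v) z := by
    intro x hx z hz
    have h1 := (hsub _ (hmem x hx z hz)).hasFDerivAt
    have h2 : HasDerivAt (fun w : ℂ => x + w • v) v z := by
      simpa using ((hasDerivAt_id z).smul_const v).const_add x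
    exact h1.comp_hasDerivAt z h2
  have hcauchy : ∀ x ∈ Metric.ball x₀ ρ, fderiv ℂ f x v = (2 * Real.pi * Complex.I : ℂ)⁻¹ •
      ∮ z in C(0, r), (1 / (z - 0) ^ 2) • f (x + z • v) := by
    intro x hx
    have hd : DifferentiableOn ℂ (fun w : ℂ => f (x + w • v)) (Metric.closedBall 0 r) :=
      fun z hz => (hline x hx z (by simpa using hz)).differentiableAt.differentiableWithinAt
    rw [hd.deriv_eq_smul_circleIntegral hr, (hline x hx 0 (by simpa using hr.le)).deriv, zero_smul,
      add_zero, smul_smul, inv_mul_cancel₀ Complex.two_pi_I_ne_zero, one_smul]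
  have hnear : Metric.ball x₀ ρ ∈ nhds x₀ := Metric.ball_mem_nhds x₀ hρ
  refine DifferentiableAt.congr_of_eventuallyEq ?_ (Filter.eventuallyEq_of_mem hnear hcauchy)
  suffices h : DifferentiableAt ℂ
      (fun x => ∮ z in C(0, r), (1 / (z - 0) ^ 2) • f (x + z • v)) x₀ from h.fun_const_smul _
  simp only [circleIntegral]
  let : MeasurableSpace E := borel E
  have : BorelSpace E := ⟨rfl⟩
  have : CompleteSpace E := FiniteDimensional.complete ℂ E
  have : ProperSpace (E →L[ℂ] ℂ) := FiniteDimensional.proper ℂ _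
  have hcircle : ∀ θ : ℝ, ‖circleMap 0 r θ‖ = r := fun θ => by simp [abs_of_pos hr]
  have hcont : ∀ x ∈ Metric.ball x₀ ρ, Continuous fun θ : ℝ =>
      deriv (circleMap 0 r) θ • (1 / (circleMap 0 r θ - 0) ^ 2) • f (x + circleMap 0 r θ • v) := by
    intro x hx
    have h1 : Continuous fun θ : ℝ => f (x + circleMap 0 r θ • v) := by
      rw [continuous_iff_continuousAt]
      intro θ
      exact ContinuousAt.comp (f := fun θ : ℝ => x + circleMap 0 r θ • v)
        (hsub _ (hmem x hx _ (hcircle θ).le)).continuousAt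
        (by fun_prop)
    have h2 : ∀ θ : ℝ, (circleMap 0 r θ - 0) ^ 2 ≠ 0 := fun θ => by simp [hr.ne']
    simp only [deriv_circleMap]
    exact (by fun_prop : Continuous fun θ : ℝ => circleMap 0 r θ * Complex.I).smul
      ((continuous_const.div (by fun_prop) h2).smul h1)
  refine (intervalIntegral.hasFDerivAt_integral_of_dominated_of_fderiv_le (𝕜 := ℂ)
    (F' := fun x θ => deriv (circleMap 0 r) θ • (1 / (circleMap 0 r θ - 0) ^ 2) •
      fderiv ℂ f (x + circleMap 0 r θ • v)) (bound := fun _ => r * ((1 / r ^ 2) * (2 * K / ρ)))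
    hnear ?_ ?_ ?_ ?_ ?_ ?_).differentiableAt
  · filter_upwards [hnear] with x hx
    exact (hcont x hx).aestronglyMeasurable
  · exact (hcont x₀ (Metric.mem_ball_self hρ)).intervalIntegrable _ _
  · have h1 : Measurable fun θ : ℝ => fderiv ℂ f (x₀ + circleMap 0 r θ • v) :=
      (measurable_fderiv ℂ f).comp
        (by fun_prop : Continuous fun θ : ℝ => x₀ + circleMap 0 r θ • v).measurable
    have h2 : Measurable fun θ : ℝ => deriv (circleMap 0 r) θ := by
      simp only [deriv_circleMap]
      exact (by fun_prop : Continuous fun θ : ℝ => circleMap 0 r θ * Complex.I).measurable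
    have h3 : Measurable fun θ : ℝ => 1 / (circleMap 0 r θ - 0) ^ 2 :=
      measurable_const.div
        (by fun_prop : Continuous fun θ : ℝ => (circleMap 0 r θ - 0) ^ 2).measurable
    exact (h2.smul (h3.smul h1)).aestronglyMeasurable
  · refine Filter.Eventually.of_forall fun θ _ x hx => ?_
    rw [norm_smul, norm_smul]
    have h1 : ‖deriv (circleMap 0 r) θ‖ = r := by simp [deriv_circleMap, abs_of_pos hr]
    have h2 : ‖1 / (circleMap 0 r θ - 0) ^ 2‖ = 1 / r ^ 2 := by simp
    rw [h1, h2]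
    gcongr
    exact hbound _ (hmem x hx _ (hcircle θ).le)
  · exact intervalIntegrable_const
  · refine Filter.Eventually.of_forall fun θ _ x hx => ?_
    have h1 := (hsub _ (hmem x hx _ (hcircle θ).le)).hasFDerivAt
    have h2 : HasFDerivAt (fun y => y + circleMap 0 r θ • v) (ContinuousLinearMap.id ℂ E) x :=
      (hasFDerivAt_id x).add_const _
    have h3 := h1.comp x h2
    rw [ContinuousLinearMap.comp_id] at h3
    exact (h3.const_smul (1 / (circleMap 0 r θ - 0) ^ 2)).const_smul (deriv (circleMap 0 r) θ)

theorem differentiableOn_fderiv_apply {f : E → ℂ} {U : Set E} (hU : IsOpen U)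
    (hf : DifferentiableOn ℂ f U) (v : E) : DifferentiableOn ℂ (fun x => fderiv ℂ f x v) U :=
  fun _ hx => (differentiableAt_fderiv_apply_of_eventually
    (Filter.eventually_of_mem (hU.mem_nhds hx) fun _ hy =>
      (hf.differentiableAt (hU.mem_nhds hy))) v).differentiableWithinAt

/-- Holomorphic functions of several variables are smooth. -/
theorem contDiffOn_of_differentiableOn {f : E → ℂ} {U : Set E} (hU : IsOpen U)
    (hf : DifferentiableOn ℂ f U) (k : ℕ) : ContDiffOn ℂ k f U := by
  induction k generalizing f with
  | zero => exact contDiffOn_zero.2 hf.continuousOn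
  | succ k ih =>
    push_cast
    rw [contDiffOn_succ_iff_fderiv_of_isOpen hU]
    refine ⟨hf, by simp, contDiffOn_clm_apply.2 fun v => ih (differentiableOn_fderiv_apply hU hf v)⟩

theorem fderiv_fderiv_apply_comm {f : E → ℂ} {U : Set E} (hU : IsOpen U)
    (hf : DifferentiableOn ℂ f U) {x : E} (hx : x ∈ U) (v w : E) :
    fderiv ℂ (fun y => fderiv ℂ f y v) x w = fderiv ℂ (fun y => fderiv ℂ f y w) x v := by
  have h2 : ContDiffAt ℂ 2 f x :=
    (contDiffOn_of_differentiableOn hU hf 2).contDiffAt (hU.mem_nhds hx)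
  have hd : DifferentiableAt ℂ (fderiv ℂ f) x :=
    (h2.fderiv_right (m := 1) (by norm_num)).differentiableAt (by norm_num)
  have hs := (h2.isSymmSndFDerivAt (by simp [minSmoothness_of_isRCLikeNormedField])).eq v w
  rw [fderiv_clm_apply hd (by fun_prop), fderiv_clm_apply hd (by fun_prop)]
  simpa using hs.symm

end SeveralVariables

/-! ### Matrices of holomorphic functions and connections -/

section MatrixCalculus

open Matrix

variable {ι K R : Type*} [CommRing K] [CommRing R] [Algebra K R]

theorem map_derivation_mul [Fintype ι] (D : Derivation K R R) (A B : Matrix ι ι R) :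
    (A * B).map D = A.map D * B + A * B.map D := by
  ext i j
  simp only [map_apply, mul_apply, Matrix.add_apply, map_sum, Derivation.leibniz, smul_eq_mul,
    ← Finset.sum_add_distrib]
  exact Finset.sum_congr rfl fun k _ => by ring

theorem map_derivation_sub (D : Derivation K R R) (A B : Matrix ι ι R) :
    (A - B).map D = A.map D - B.map D :=
  Matrix.map_sub _ (map_sub D) A B

theorem map_derivation_add (D : Derivation K R R) (A B : Matrix ι ι R) :
    (A + B).map D = A.map D + B.map D :=
  Matrix.map_add _ (map_add D) A B

/-- The effect of a gauge transformation on curvature: if `M P_j = ∂_j M + w_j M`, then the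
curvature `∂_i P_j - ∂_j P_i + [P_i, P_j]` is conjugate by `M` to that of `w`. -/
theorem mul_curvature_eq [Fintype ι] {δ : Type*} (D : δ → Derivation K R R)
    (hD : ∀ i j f, D i (D j f) = D j (D i f)) (M : Matrix ι ι R) (P w : δ → Matrix ι ι R)
    (h : ∀ j, M * P j = M.map (D j) + w j * M) (i j : δ) :
    M * ((P j).map (D i) - (P i).map (D j) + (P i * P j - P j * P i)) =
      ((w j).map (D i) - (w i).map (D j) + (w i * w j - w j * w i)) * M := by
  -- apply `D i` to the hypothesis and eliminate `∂_i M` in front of `P j`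
  have key : ∀ i j, M * ((P j).map (D i) + P i * P j) = (M.map (D j)).map (D i)
      + (w j).map (D i) * M + w j * M.map (D i) + w i * M.map (D j) + w i * w j * M := by
    intro i j
    have h1 := congrArg (fun A : Matrix ι ι R => A.map (D i)) (h j)
    simp only [map_derivation_mul, map_derivation_add] at h1
    have h2 : M * (P i * P j) = M.map (D i) * P j + w i * (M.map (D j) + w j * M) := by
      rw [← mul_assoc, h i, add_mul, mul_assoc, h j]
    rw [mul_add, h2, mul_add, ← mul_assoc (w i), ← sub_eq_zero]
    rw [← sub_eq_zero] at h1
    rw [← h1]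
    abel
  have hcomm : (M.map (D j)).map (D i) = (M.map (D i)).map (D j) := by
    ext a b; simp [hD i j]
  calc M * ((P j).map (D i) - (P i).map (D j) + (P i * P j - P j * P i))
      = M * ((P j).map (D i) + P i * P j) - M * ((P i).map (D j) + P j * P i) := by
        rw [← mul_sub]; congr 1; abel
    _ = _ := by
        rw [key i j, key j i, hcomm, add_mul, sub_mul, sub_mul]
        abel

/-- Uniqueness of the Levi-Civita connection: Christoffel symbols which are symmetric and
compatible with the metric are given by the Koszul formula. Here `dg i j l` stands for `∂_i g_jl`
and `P a i j` for `Γ^a_ij`. -/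
theorem koszul_unique [Fintype ι] [DecidableEq ι] {k : Type*} [Field k] [CharZero k]
    (g : Matrix ι ι k) (hg : IsUnit g.det) (dg : ι → ι → ι → k) (P : ι → ι → ι → k)
    (hP : ∀ a i j, P a i j = P a j i)
    (hdg : ∀ i j l, dg i j l = (∑ a, g j a * P a i l) + ∑ a, g l a * P a i j) (a i j : ι) :
    (1 / 2 : k) * ∑ l, g⁻¹ a l * (dg i j l + dg j i l - dg l i j) = P a i j := by
  have h1 : ∀ l, dg i j l + dg j i l - dg l i j = 2 * ∑ b, g l b * P b i j := by
    intro l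
    rw [hdg i j l, hdg j i l, hdg l i j]
    have e1 : ∀ b c d, ∑ x, g b x * P x c d = ∑ x, g b x * P x d c := fun b c d =>
      Finset.sum_congr rfl fun x _ => by rw [hP]
    rw [e1 j i l, e1 l j i, e1 i j l]
    ring
  simp only [h1]
  have h2 : g⁻¹ *ᵥ (g *ᵥ fun b => P b i j) = fun b => P b i j := by
    rw [mulVec_mulVec, nonsing_inv_mul _ hg, one_mulVec]
  have h3 := congrFun h2 a
  simp only [mulVec, dotProduct] at h3
  rw [← h3, Finset.mul_sum]
  exact Finset.sum_congr rfl fun l _ => by ring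

end MatrixCalculus

/-- The structure constants of a commutative associative algebra with basis `∂_i`, together with
the Gram matrix `G` of an invariant non-degenerate symmetric bilinear form. The matrix `C i`
represents the multiplication by `∂_i`, so that `∂_i ∘ ∂_j = ∑ a, C i a j • ∂_a`. -/
structure InvariantAlgebra (n : ℕ) (R : Type*) [CommRing R] where
  C : Fin n → Matrix (Fin n) (Fin n) R
  G : Matrix (Fin n) (Fin n) R
  comm : ∀ i j a, C i a j = C j a i
  assoc : ∀ i j, C i * C j = ∑ k, C i k j • C k
  symm : G.transpose = G
  isUnit_det : IsUnit G.det
  invariant : ∀ i, G * C i = (C i).transpose * G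

namespace InvariantAlgebra

open Matrix

variable {n : ℕ} {K R : Type*} [CommRing K] [CommRing R] [Algebra K R] (S : InvariantAlgebra n R)

/-- Extension of scalars along a ring homomorphism. -/
def map {R' : Type*} [CommRing R'] (f : R →+* R') : InvariantAlgebra n R' where
  C i := (S.C i).map f
  G := S.G.map f
  comm i j a := by simp [S.comm i j a]
  assoc i j := by
    rw [← Matrix.map_mul, S.assoc]
    ext a b
    simp [Matrix.sum_apply]
  symm := by rw [← transpose_map, S.symm]
  isUnit_det := by
    have := S.isUnit_det.map f
    rwa [RingHom.map_det] at this
  invariant i := by rw [← Matrix.map_mul, S.invariant, Matrix.map_mul, transpose_map]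

/-- The matrix of the multiplication by the element with coordinates `T`. -/
def mulMat (T : Fin n → R) : Matrix (Fin n) (Fin n) R := ∑ i, T i • S.C i

theorem mulMat_def (T : Fin n → R) : S.mulMat T = ∑ i, T i • S.C i := rfl

theorem mulMat_apply (T : Fin n → R) (a b : Fin n) :
    S.mulMat T a b = ∑ i, T i * S.C i a b := by
  simp [mulMat, Matrix.sum_apply]

/-- The column `b` of the multiplication by `T` is `∂_b ∘ T`. -/
theorem mulMat_apply' (T : Fin n → R) (a b : Fin n) :
    S.mulMat T a b = (S.C b *ᵥ T) a := by
  simp only [mulMat_apply, mulVec, dotProduct]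
  exact Finset.sum_congr rfl fun i _ => by rw [S.comm i b a, mul_comm]

theorem mulMat_mulVec_comm (T U : Fin n → R) : S.mulMat T *ᵥ U = S.mulMat U *ᵥ T := by
  ext a
  simp only [mulVec, dotProduct, mulMat_apply, Finset.sum_mul]
  rw [Finset.sum_comm]
  exact Finset.sum_congr rfl fun i _ => Finset.sum_congr rfl fun j _ => by
    rw [S.comm i j a]; ring

theorem C_mul_C_comm (i j : Fin n) : S.C i * S.C j = S.C j * S.C i := by
  rw [S.assoc, S.assoc]
  exact Finset.sum_congr rfl fun k _ => by rw [S.comm i j k]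

theorem mulMat_mul_C (T : Fin n → R) (j : Fin n) :
    S.mulMat T * S.C j = S.C j * S.mulMat T := by
  simp only [mulMat, Finset.sum_mul, Finset.mul_sum, smul_mul_assoc, mul_smul_comm,
    S.C_mul_C_comm _ j]

/-- Associativity: multiplication by `T ∘ U` is the composition of the multiplications. -/
theorem mulMat_mul_mulMat (T U : Fin n → R) :
    S.mulMat T * S.mulMat U = S.mulMat (S.mulMat T *ᵥ U) := by
  have h : ∀ j, S.mulMat T * S.C j = S.mulMat (S.mulMat T *ᵥ Pi.single j 1) := by
    intro j
    simp only [mulMat, Finset.sum_mul, smul_mul_assoc, S.assoc, Finset.smul_sum]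
    rw [Finset.sum_comm]
    refine Finset.sum_congr rfl fun k _ => ?_
    rw [mulVec_single_one, col_apply, Matrix.sum_apply, Finset.sum_smul]
    exact Finset.sum_congr rfl fun i _ => by simp [smul_smul]
  rw [S.mulMat_def U, Finset.mul_sum]
  simp only [mul_smul_comm, h]
  ext a b
  simp only [Matrix.sum_apply, Matrix.smul_apply, mulMat_apply, mulVec_single_one, col_apply,
    mulVec, dotProduct, smul_eq_mul, Finset.mul_sum, Finset.sum_mul]
  rw [Finset.sum_comm]
  exact Finset.sum_congr rfl fun i _ => Finset.sum_congr rfl fun j _ =>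
    Finset.sum_congr rfl fun k _ => by ring

theorem G_mul_mulMat (T : Fin n → R) : S.G * S.mulMat T = (S.mulMat T)ᵀ * S.G := by
  simp only [mulMat, Finset.mul_sum, transpose_sum, transpose_smul, Finset.sum_mul,
    smul_mul_assoc, mul_smul_comm, S.invariant]

theorem map_mulMat {R' : Type*} [CommRing R'] (f : R →+* R') (T : Fin n → R) :
    (S.mulMat T).map f = (S.map f).mulMat (fun i => f (T i)) := by
  ext a b
  simp [mulMat_apply, map]

theorem map_derivation_mulMat (D : Derivation K R R) (hD : ∀ i, (S.C i).map D = 0)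
    (T : Fin n → R) : (S.mulMat T).map D = S.mulMat (fun i => D (T i)) := by
  ext a b
  have h : ∀ i, D (S.C i a b) = 0 := fun i => by simpa using congrFun (congrFun (hD i) a) b
  simp [mulMat_apply, h, mul_comm]

/-- The Gram matrix `G M M` of the form `(X, Y) ↦ G (T ∘ X, T ∘ Y)`, where `M` is the
multiplication by `T`. -/
def twist (T : Fin n → R) : Matrix (Fin n) (Fin n) R := S.G * S.mulMat T * S.mulMat T

theorem twist_transpose (T : Fin n → R) : (S.twist T)ᵀ = S.twist T := by
  simp only [twist, transpose_mul, S.symm]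
  rw [← S.G_mul_mulMat, ← mul_assoc, ← S.G_mul_mulMat]

/-- `g_ij = ∑ a, c_ij^a η_a` for the covector `η = G (T ∘ T, ·)`. -/
theorem twist_apply (T : Fin n → R) (i j : Fin n) :
    S.twist T i j = ∑ a, S.C i a j * ((S.G * S.mulMat T) *ᵥ T) a := by
  have h : S.twist T j i = ((S.G * S.mulMat T) *ᵥ (S.C i *ᵥ T)) j := by
    simp only [twist, mul_apply (M := S.G * S.mulMat T), mulMat_apply' S T _ i, mulVec,
      dotProduct]
  rw [← S.twist_transpose, transpose_apply, h, mulVec_mulVec, mul_assoc, S.mulMat_mul_C,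
    ← mul_assoc, S.invariant, mul_assoc, ← mulVec_mulVec]
  simp [mulVec, dotProduct]

/-- Contracting `g` with the unit `e` gives the covector `η = G (T ∘ T, ·)`. -/
theorem sum_mul_twist (T e : Fin n → R) (he : S.mulMat e = 1) (l : Fin n) :
    ∑ j, e j * S.twist T j l = ((S.G * S.mulMat T) *ᵥ T) l := by
  have h : ∀ a, ∑ j, e j * S.C j a l = (1 : Matrix (Fin n) (Fin n) R) a l := fun a => by
    rw [← he, mulMat_apply]
  simp only [twist_apply, Finset.mul_sum]
  rw [Finset.sum_comm]
  simp only [← mul_assoc, ← Finset.sum_mul, h]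
  simp [Matrix.one_apply]

/-- `η (e) = G (T, T)` for the covector `η = G (T ∘ T, ·)`. -/
theorem sum_mul_coidentity (T e : Fin n → R) (he : S.mulMat e = 1) :
    ∑ l, e l * ((S.G * S.mulMat T) *ᵥ T) l = T ⬝ᵥ (S.G *ᵥ T) := by
  have h : S.mulMat T *ᵥ e = T := by rw [S.mulMat_mulVec_comm, he, one_mulVec]
  change e ⬝ᵥ ((S.G * S.mulMat T) *ᵥ T) = _
  rw [S.G_mul_mulMat, ← mulVec_mulVec, dotProduct_mulVec, vecMul_transpose, h]

section Derivations

variable (D : Fin n → Derivation K R R) (T : Fin n → R)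

/-- The Jacobian matrix of `T`. -/
def jacobian : Matrix (Fin n) (Fin n) R := Matrix.of fun k j => D j (T k)

variable (hC : ∀ j i, (S.C i).map (D j) = 0) (hG : ∀ j, S.G.map (D j) = 0)
include hC hG

/-- `∂_i η_l = 2 (G M J)_li` for the covector `η = G (T ∘ T, ·)`. -/
theorem derivation_coidentity (i l : Fin n) :
    D i (((S.G * S.mulMat T) *ᵥ T) l) = 2 * (S.G * S.mulMat T * jacobian D T) l i := by
  have h1 : ∀ a b, D i ((S.G * S.mulMat T) a b)
      = (S.G * S.mulMat (fun k => D i (T k))) a b := by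
    intro a b
    have := congrFun (congrFun (map_derivation_mul (D i) S.G (S.mulMat T)) a) b
    rwa [hG, zero_mul, zero_add, S.map_derivation_mulMat (D i) (hC i)] at this
  have h2 : D i (((S.G * S.mulMat T) *ᵥ T) l) =
      ((S.G * S.mulMat T) *ᵥ fun k => D i (T k)) l
        + ((S.G * S.mulMat (fun k => D i (T k))) *ᵥ T) l := by
    simp only [mulVec, dotProduct, map_sum, Derivation.leibniz, smul_eq_mul, h1,
      Finset.sum_add_distrib]
    congr 1
    exact Finset.sum_congr rfl fun k _ => mul_comm _ _
  rw [h2, ← mulVec_mulVec, ← mulVec_mulVec, S.mulMat_mulVec_comm _ T, mulVec_mulVec, ← two_mul]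
  rfl

/-- The unit field is parallel for the Levi-Civita connection of `g = twist T` if and only if the
covector `η = G (T ∘ T, ·)` is closed and `η (e) = G (T, T)` has vanishing derivatives. -/
theorem koszul_unit_iff (h2 : IsUnit (2 : R)) (e : Fin n → R) (he : S.mulMat e = 1)
    (heD : ∀ i j, D i (e j) = 0) :
    (∀ i l, ∑ j, e j * (D i (S.twist T j l) + D j (S.twist T i l) - D l (S.twist T i j)) = 0) ↔
      (S.G * S.mulMat T * jacobian D T)ᵀ = S.G * S.mulMat T * jacobian D T ∧
        ∀ i, D i (T ⬝ᵥ (S.G *ᵥ T)) = 0 := by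
  set η := (S.G * S.mulMat T) *ᵥ T with hη
  have hconst : ∀ i j f, D i (e j * f) = e j * D i f := fun i j f => by simp [heD]
  have hA : ∀ i l, ∑ j, e j * D i (S.twist T j l) = D i (η l) := fun i l => by
    rw [hη, ← S.sum_mul_twist T e he l, map_sum]
    simp only [hconst]
  have htr : ∀ i j, S.twist T i j = S.twist T j i := fun i j =>
    congrFun (congrFun (S.twist_transpose T) j) i
  have hsum : ∀ i l,
      ∑ j, e j * (D i (S.twist T j l) + D j (S.twist T i l) - D l (S.twist T i j)) =
        D i (η l) - D l (η i) + ∑ j, e j * D j (S.twist T i l) := fun i l => by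
    simp only [mul_sub, mul_add, Finset.sum_sub_distrib, Finset.sum_add_distrib, hA]
    simp only [htr i, hA]
    ring
  have hclosed : (S.G * S.mulMat T * jacobian D T)ᵀ = S.G * S.mulMat T * jacobian D T ↔
      ∀ i l, D i (η l) = D l (η i) := by
    simp only [hη, S.derivation_coidentity D T hC hG, h2.mul_right_inj]
    exact ⟨fun h i l => (congrFun (congrFun h i) l), fun h => by ext i l; exact h i l⟩
  have hE : ∀ l, D l (T ⬝ᵥ (S.G *ᵥ T)) = ∑ j, e j * D l (η j) := fun l => by
    rw [← S.sum_mul_coidentity T e he, map_sum]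
    simp only [hconst, hη]
  have hCD : ∀ j i a l, D j (S.C i a l) = 0 := fun j i a l => by
    simpa using congrFun (congrFun (hC j i) a) l
  have hB : ∀ i l j, D j (S.twist T i l) = ∑ a, S.C i a l * D j (η a) := fun i l j => by
    rw [S.twist_apply, map_sum]
    exact Finset.sum_congr rfl fun a _ => by simp [hCD, hη]
  rw [hclosed]
  simp only [hsum, hE]
  -- the expression in `hsum` has an antisymmetric part, which vanishes when `η` is closed, and a
  -- symmetric part, whose contraction with `e` is the derivative of `η (e)`
  constructor
  · intro h
    have hcl : ∀ i l, D i (η l) = D l (η i) := by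
      intro i l
      have h3 := h i l
      have h4 := h l i
      simp only [htr l i] at h4
      refine h2.mul_right_inj.1 ?_
      linear_combination h3 - h4
    refine ⟨hcl, fun l => ?_⟩
    have h5 : ∀ i, ∑ j, e j * D j (S.twist T i l) = 0 := fun i => by
      have := h i l
      rwa [hcl i l, sub_self, zero_add] at this
    have h6 : ∑ i, e i * ∑ j, e j * D j (S.twist T i l) = 0 := by simp [h5]
    simp only [Finset.mul_sum] at h6
    rw [Finset.sum_comm] at h6
    rw [← h6]
    refine Finset.sum_congr rfl fun j _ => ?_
    rw [hcl l j, ← hA j l, Finset.mul_sum]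
    exact Finset.sum_congr rfl fun i _ => by ring
  · rintro ⟨hcl, hE0⟩ i l
    rw [hcl i l, sub_self, zero_add]
    simp only [hB, Finset.mul_sum]
    rw [Finset.sum_comm]
    refine Finset.sum_eq_zero fun a _ => ?_
    have := hE0 a
    simp only [hcl a] at this
    calc ∑ j, e j * (S.C i a l * D j (η a)) = S.C i a l * ∑ j, e j * D j (η a) := by
          rw [Finset.mul_sum]; exact Finset.sum_congr rfl fun j _ => by ring
      _ = 0 := by rw [this, mul_zero]

end Derivations

/-- The matrix `γ = M⁻¹ G⁻¹ Jᵀ G` of the endomorphism `X ↦ T⁻¹ ∘ grad (ψ (X))`. -/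
def rotation (D : Fin n → Derivation K R R) (T : Fin n → R) : Matrix (Fin n) (Fin n) R :=
  (S.mulMat T)⁻¹ * S.G⁻¹ * (jacobian D T)ᵀ * S.G

section Rotation

variable (D : Fin n → Derivation K R R) (T : Fin n → R) (hT : IsUnit (S.mulMat T).det)
include hT

theorem mulMat_mul_rotation :
    (S.mulMat T)ᵀ * (S.G * S.rotation D T) = (jacobian D T)ᵀ * S.G := by
  rw [← mul_assoc, ← S.G_mul_mulMat, rotation]
  simp only [mul_assoc]
  rw [mul_nonsing_inv_cancel_left _ _ hT, mul_nonsing_inv_cancel_left _ _ S.isUnit_det]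

/-- The symmetry of `γ` says that the covector `G (T ∘ T, ·)` is closed. -/
theorem rotation_symm_iff : S.G * S.rotation D T = (S.rotation D T)ᵀ * S.G ↔
    (S.G * S.mulMat T * jacobian D T)ᵀ = S.G * S.mulMat T * jacobian D T := by
  have h1 := S.mulMat_mul_rotation D T hT
  have h2 : (S.rotation D T)ᵀ * S.G * S.mulMat T = S.G * jacobian D T := by
    have := congrArg transpose h1
    simpa only [transpose_mul, transpose_transpose, S.symm] using this
  have h3 : (S.mulMat T)ᵀ * (S.G * S.rotation D T) * S.mulMat T
      = (S.G * S.mulMat T * jacobian D T)ᵀ := by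
    rw [h1, transpose_mul, transpose_mul, S.symm, mul_assoc, S.G_mul_mulMat]
  have h4 : (S.mulMat T)ᵀ * ((S.rotation D T)ᵀ * S.G) * S.mulMat T
      = S.G * S.mulMat T * jacobian D T := by
    rw [mul_assoc, h2, ← mul_assoc, S.G_mul_mulMat]
  rw [← h3, ← h4]
  refine ⟨fun h => by rw [h], fun h => ?_⟩
  have hT' : IsUnit (S.mulMat T) := (isUnit_iff_isUnit_det _).2 hT
  exact ((isUnit_transpose _).2 hT').mul_left_cancel (hT'.mul_right_cancel h)

/-- For symmetric `γ`, the derivatives of `T` are `∂_X T = γ (T ∘ X)`. -/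
theorem rotation_mul_mulMat (hγ : S.G * S.rotation D T = (S.rotation D T)ᵀ * S.G) :
    S.rotation D T * S.mulMat T = jacobian D T := by
  have h2 : (S.rotation D T)ᵀ * S.G * S.mulMat T = S.G * jacobian D T := by
    have := congrArg transpose (S.mulMat_mul_rotation D T hT)
    simpa only [transpose_mul, transpose_transpose, S.symm] using this
  rw [← hγ, mul_assoc] at h2
  exact ((isUnit_iff_isUnit_det _).2 S.isUnit_det).mul_left_cancel h2

end Rotation

/-- The connection form `w_j = [C_j, γ]`. -/
def connForm (D : Fin n → Derivation K R R) (T : Fin n → R) (j : Fin n) :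
    Matrix (Fin n) (Fin n) R :=
  S.C j * S.rotation D T - S.rotation D T * S.C j

/-- The matrices `P_j = M⁻¹ (∂_j M + w_j M)` of the Levi-Civita connection of `twist T`. -/
def connection (D : Fin n → Derivation K R R) (T : Fin n → R) (j : Fin n) :
    Matrix (Fin n) (Fin n) R :=
  (S.mulMat T)⁻¹ * ((S.mulMat T).map (D j) + S.connForm D T j * S.mulMat T)

section Connection

variable (D : Fin n → Derivation K R R) (T : Fin n → R) (hT : IsUnit (S.mulMat T).det)
include hT

theorem mulMat_mul_connection (j : Fin n) : S.mulMat T * S.connection D T j =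
    (S.mulMat T).map (D j) + S.connForm D T j * S.mulMat T := by
  rw [connection, mul_nonsing_inv_cancel_left _ _ hT]

/-- The curvature of `connection` is conjugate to that of `w_j = [C_j, γ]`, whose vanishing is the
system of Darboux-Egoroff equations. -/
theorem curvature_eq_zero_iff (hC : ∀ j i, (S.C i).map (D j) = 0)
    (hD : ∀ i j f, D i (D j f) = D j (D i f)) (i j : Fin n) :
    (S.connection D T j).map (D i) - (S.connection D T i).map (D j)
        + (S.connection D T i * S.connection D T j - S.connection D T j * S.connection D T i) = 0 ↔
      ⁅S.C i, (S.rotation D T).map (D j)⁆ - ⁅S.C j, (S.rotation D T).map (D i)⁆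
        = ⁅⁅S.C i, S.rotation D T⁆, ⁅S.C j, S.rotation D T⁆⁆ := by
  have hU : IsUnit (S.mulMat T) := (isUnit_iff_isUnit_det _).2 hT
  have h := mul_curvature_eq D hD (S.mulMat T) (S.connection D T) (S.connForm D T)
    (S.mulMat_mul_connection D T hT) i j
  have hw : ∀ i j, (S.connForm D T j).map (D i) = ⁅S.C j, (S.rotation D T).map (D i)⁆ := by
    intro i j
    rw [connForm, map_derivation_sub, map_derivation_mul, map_derivation_mul, hC, zero_mul,
      mul_zero, zero_add, add_zero, Ring.lie_def]
  rw [← hU.mul_right_eq_zero, h, hU.mul_left_eq_zero, hw, hw, ← Ring.lie_def, connForm, connForm,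
    ← Ring.lie_def, ← Ring.lie_def, ← sub_eq_zero (b := ⁅⁅S.C i, _⁆, _⁆), ← neg_eq_zero]
  refine Eq.congr ?_ rfl
  abel

variable (hC : ∀ j i, (S.C i).map (D j) = 0) (hG : ∀ j, S.G.map (D j) = 0)
  (hγ : S.G * S.rotation D T = (S.rotation D T)ᵀ * S.G)
include hC hγ

/-- The connection is torsion free: `∂_j M ∂_i + [C_j, γ] M ∂_i` equals
`C_i J ∂_j + C_j J ∂_i - J (∂_i ∘ ∂_j)`, which is symmetric in `i` and `j`. -/
theorem connection_torsion_free (a i j : Fin n) :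
    S.connection D T j a i = S.connection D T i a j := by
  have key : ∀ i j a, ((S.mulMat T).map (D j) + S.connForm D T j * S.mulMat T) a i =
      (S.C i * jacobian D T) a j + (S.C j * jacobian D T) a i
        - ∑ k, jacobian D T a k * S.C j k i := by
    intro i j a
    rw [connForm, sub_mul, mul_assoc, S.rotation_mul_mulMat D T hT hγ, mul_assoc,
      ← S.mulMat_mul_C, ← mul_assoc, S.rotation_mul_mulMat D T hT hγ,
      S.map_derivation_mulMat (D j) (hC j)]
    simp only [Matrix.add_apply, Matrix.sub_apply, mulMat_apply' S _ a i]
    rw [mul_apply (M := jacobian D T), mul_apply (M := S.C i), add_sub_assoc]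
    rfl
  simp only [connection, mul_apply, key]
  refine Finset.sum_congr rfl fun b _ => ?_
  simp only [S.comm j i]
  ring

include hG

/-- The connection is compatible with the metric `twist T`. -/
theorem map_derivation_twist (j : Fin n) : (S.twist T).map (D j) =
    S.twist T * S.connection D T j + (S.twist T * S.connection D T j)ᵀ := by
  have h1 : S.twist T * S.connection D T j = S.G * S.mulMat T * (S.mulMat T).map (D j)
      + S.G * S.mulMat T * S.connForm D T j * S.mulMat T := by
    rw [twist, mul_assoc, S.mulMat_mul_connection D T hT, mul_add, mul_assoc (S.G * S.mulMat T)]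
  have hdM : S.G * (S.mulMat T).map (D j) = ((S.mulMat T).map (D j))ᵀ * S.G := by
    rw [S.map_derivation_mulMat (D j) (hC j), S.G_mul_mulMat]
  have h2 : (S.G * S.mulMat T * (S.mulMat T).map (D j))ᵀ
      = S.G * (S.mulMat T).map (D j) * S.mulMat T := by
    rw [transpose_mul, transpose_mul, S.symm, ← S.G_mul_mulMat, ← mul_assoc, ← hdM]
  have h3 : S.G * S.connForm D T j = -((S.connForm D T j)ᵀ * S.G) := by
    simp only [connForm, transpose_sub, transpose_mul, mul_sub, sub_mul]
    rw [← mul_assoc, ← mul_assoc, S.invariant, hγ, mul_assoc, mul_assoc, hγ, S.invariant]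
    simp only [mul_assoc, neg_sub]
  have h4 : (S.G * S.mulMat T * S.connForm D T j * S.mulMat T)ᵀ
      = -(S.G * S.mulMat T * S.connForm D T j * S.mulMat T) := by
    have h5 : (S.connForm D T j)ᵀ * S.G = -(S.G * S.connForm D T j) := by rw [h3, neg_neg]
    rw [S.G_mul_mulMat]
    simp only [transpose_mul, transpose_transpose, S.symm, mul_assoc]
    rw [← mul_assoc _ S.G, h5]
    simp only [neg_mul, mul_neg, mul_assoc]
  rw [h1, transpose_add, h2, h4, twist, map_derivation_mul, map_derivation_mul, hG, zero_mul,
    zero_add]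
  abel

end Connection

end InvariantAlgebra

/-! ### Coordinates and the differential algebra of holomorphic functions -/

section HolomorphicFunctions

variable {n : ℕ} {N : Type*} [TopologicalSpace N] {t : OpenPartialHomeomorph N (Fin n → ℂ)}

/-- The algebra of holomorphic functions on `N`, described in the coordinates `t`: the functions
`f` for which `f ∘ t⁻¹` is complex differentiable on the image of `t`. They are the holomorphic functions on all of
`N` when `t` is a global coordinate system. -/
def holFun (t : OpenPartialHomeomorph N (Fin n → ℂ)) : Subalgebra ℂ (N → ℂ) where
  carrier := {f | DifferentiableOn ℂ (fun x => f (t.symm x)) t.target}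
  mul_mem' hf hg := hf.mul hg
  add_mem' hf hg := hf.add hg
  algebraMap_mem' c := differentiableOn_const c

/-- Evaluation of holomorphic functions at a point. -/
def evalAt (t : OpenPartialHomeomorph N (Fin n → ℂ)) (p : N) : holFun t →+* ℂ :=
  (Pi.evalRingHom (fun _ : N => ℂ) p).comp (holFun t).val.toRingHom

@[simp]
theorem evalAt_apply (p : N) (f : holFun t) : evalAt t p f = (f : N → ℂ) p := rfl

theorem holFun.isUnit_of_ne_zero (f : holFun t) (hf : ∀ p, (f : N → ℂ) p ≠ 0) : IsUnit f := by
  have h : (fun p => ((f : N → ℂ) p)⁻¹) ∈ holFun t :=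
    DifferentiableOn.inv f.2 fun x hx => hf _
  refine IsUnit.of_mul_eq_one ⟨_, h⟩ (Subtype.ext (funext fun p => ?_))
  exact mul_inv_cancel₀ (hf p)

theorem pd_mem_holFun (i : Fin n) (f : holFun t) : pd t i f ∈ holFun t := by
  refine (differentiableOn_fderiv_apply t.open_target f.2 (Pi.single i 1)).congr fun x hx => ?_
  simp only [pd, t.right_inv hx]

end HolomorphicFunctions

section Coordinates

variable {n : ℕ} {N : Type*} [TopologicalSpace N] [ChartedSpace (Fin n → ℂ) N]
  {t : OpenPartialHomeomorph N (Fin n → ℂ)}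

namespace IsCoordSystem

variable (ht : IsCoordSystem t)
include ht

theorem mem_source (p : N) : p ∈ t.source := by rw [ht.source_eq]; trivial

theorem mdifferentiable : t.MDifferentiable 𝓘(ℂ, Fin n → ℂ) 𝓘(ℂ, Fin n → ℂ) := by
  constructor
  · exact (contMDiffOn_of_mem_maximalAtlas ht.mem_atlas).mdifferentiableOn (by simp)
  · exact (contMDiffOn_symm_of_mem_maximalAtlas ht.mem_atlas).mdifferentiableOn (by simp)

/-- The differential of the coordinate system at `p`. -/
def coordEquiv (p : N) : Tan n p ≃L[ℂ] (Fin n → ℂ) :=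
  ht.mdifferentiable.mfderiv (ht.mem_source p)

/-- The basis `(∂_i)` of a tangent space; its coordinates are the differentials `dtⁱ`. -/
def basis (p : N) : Module.Basis (Fin n) ℂ (Tan n p) :=
  Module.Basis.ofEquivFun (ht.coordEquiv p).toLinearEquiv

theorem basis_apply (p : N) (i : Fin n) : ht.basis p i = coordField t i p := by
  have h : coordField t i p = (ht.coordEquiv p).symm (Pi.single i 1) := by
    have h0 := DFunLike.congr_fun (ContinuousLinearMap.inverse_equiv (ht.coordEquiv p))
      (Pi.single i 1 : Fin n → ℂ)
    exact h0
  rw [h, basis, Module.Basis.coe_ofEquivFun]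
  rfl

theorem basis_repr (p : N) (v : Tan n p) (i : Fin n) : (ht.basis p).repr v i = dt t i p v := by
  have h1 : HasMFDerivAt 𝓘(ℂ, Fin n → ℂ) 𝓘(ℂ, Fin n → ℂ) t p _ :=
    (ht.mdifferentiable.mdifferentiableAt (ht.mem_source p)).hasMFDerivAt
  have h2 := ((ContinuousLinearMap.proj (R := ℂ) (φ := fun _ : Fin n => ℂ) i).hasMFDerivAt
    (x := t p)).comp p h1
  have h3 : dt t i p v = (mfderiv 𝓘(ℂ, Fin n → ℂ) 𝓘(ℂ, Fin n → ℂ) t p v) i := by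
    exact DFunLike.congr_fun h2.mfderiv v
  rw [h3]
  rfl

theorem dt_coordField (i j : Fin n) (p : N) :
    dt t i p (coordField t j p) = if j = i then 1 else 0 := by
  rw [← ht.basis_repr, ← ht.basis_apply, Module.Basis.repr_self, Finsupp.single_apply]

theorem symm_apply (p : N) : t.symm (t p) = p := t.left_inv (ht.mem_source p)

theorem mem_target (p : N) : t p ∈ t.target := t.map_source (ht.mem_source p)

theorem mdifferentiable_iff (f : N → ℂ) : MDifferentiable 𝓘(ℂ, Fin n → ℂ) 𝓘(ℂ, ℂ) f ↔
    DifferentiableOn ℂ (fun x => f (t.symm x)) t.target := by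
  constructor
  · intro hf
    rw [← mdifferentiableOn_iff_differentiableOn]
    exact hf.comp_mdifferentiableOn ht.mdifferentiable.2
  · intro hf p
    have h1 := (hf.differentiableAt
      (t.open_target.mem_nhds (ht.mem_target p))).mdifferentiableAt.comp p (
      ht.mdifferentiable.mdifferentiableAt (ht.mem_source p))
    refine h1.congr_of_eventuallyEq (Filter.Eventually.of_forall fun q => ?_)
    simp [ht.symm_apply]

end IsCoordSystem

namespace IsCoordSystem

variable (ht : IsCoordSystem t)

include ht in
theorem differentiableAt (f : holFun t) (p : N) :
    DifferentiableAt ℂ (fun x => (f : N → ℂ) (t.symm x)) (t p) :=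
  DifferentiableOn.differentiableAt f.2 (t.open_target.mem_nhds (ht.mem_target p))

/-- The partial derivative `∂_i` as a derivation of the algebra of holomorphic functions. -/
def pdDer (i : Fin n) : Derivation ℂ (holFun t) (holFun t) :=
  Derivation.mk'
    { toFun := fun f => ⟨pd t i f, pd_mem_holFun i f⟩
      map_add' := fun f g => Subtype.ext <| funext fun p => by
        have := fderiv_fun_add (ht.differentiableAt f p) (ht.differentiableAt g p)
        exact DFunLike.congr_fun this _
      map_smul' := fun c f => Subtype.ext <| funext fun p => by
        have := fderiv_fun_const_smul (ht.differentiableAt f p) c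
        exact DFunLike.congr_fun this _ }
    fun f g => Subtype.ext <| funext fun p => by
      have := DFunLike.congr_fun (fderiv_fun_mul (ht.differentiableAt f p)
        (ht.differentiableAt g p)) (Pi.single i (1 : ℂ))
      simp only [_root_.add_apply, _root_.smul_apply, smul_eq_mul,
        ht.symm_apply] at this
      exact this

@[simp]
theorem coe_pdDer (i : Fin n) (f : holFun t) : (ht.pdDer i f : N → ℂ) = pd t i f := rfl

theorem pdDer_comm (i j : Fin n) (f : holFun t) :
    ht.pdDer i (ht.pdDer j f) = ht.pdDer j (ht.pdDer i f) := by
  refine Subtype.ext (funext fun p => ?_)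
  have key : ∀ i j, pd t i (pd t j f) p = fderiv ℂ (fun y => fderiv ℂ
      (fun x => (f : N → ℂ) (t.symm x)) y (Pi.single j 1)) (t p) (Pi.single i 1) := by
    intro i j
    rw [pd]
    congr 1
    refine Filter.EventuallyEq.fderiv_eq ?_
    filter_upwards [t.open_target.mem_nhds (ht.mem_target p)] with x hx
    simp only [pd, t.right_inv hx]
  simp only [coe_pdDer, key]
  exact fderiv_fderiv_apply_comm t.open_target f.2 (ht.mem_target p) _ _

include ht in
theorem exists_eq_const_iff [PreconnectedSpace N] (f : holFun t) :
    (∃ c, ∀ p, (f : N → ℂ) p = c) ↔ ∀ i, ht.pdDer i f = 0 := by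
  constructor
  · rintro ⟨c, hc⟩ i
    have : f = algebraMap ℂ (holFun t) c := Subtype.ext (funext hc)
    rw [this, Derivation.map_algebraMap]
  · intro h
    have hpre : IsPreconnected t.target := by
      rw [← t.image_source_eq_target, ht.source_eq]
      refine isPreconnected_univ.image _ ?_
      rw [← ht.source_eq]; exact t.continuousOn
    have hz : t.target.EqOn (fderiv ℂ fun x => (f : N → ℂ) (t.symm x)) 0 := by
      intro x hx
      refine ContinuousLinearMap.coe_injective (LinearMap.pi_ext' fun i => LinearMap.ext_ring ?_)
      have := congrFun (congrArg (fun g : holFun t => (g : N → ℂ)) (h i)) (t.symm x)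
      simp only [coe_pdDer, pd, t.right_inv hx] at this
      exact this
    rcases isEmpty_or_nonempty N with hN | ⟨⟨q⟩⟩
    · exact ⟨0, fun p => (hN.false p).elim⟩
    · refine ⟨(f : N → ℂ) q, fun p => ?_⟩
      have := t.open_target.is_const_of_fderiv_eq_zero hpre f.2 hz (ht.mem_target p)
        (ht.mem_target q)
      simpa only [ht.symm_apply] using this

end IsCoordSystem

end Coordinates

/-! ### The constant algebra in coordinates -/

open Matrix

theorem map_nonsing_inv {ι R R' : Type*} [Fintype ι] [DecidableEq ι] [CommRing R] [CommRing R']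
    (f : R →+* R') (A : Matrix ι ι R) (hA : IsUnit A.det) : A⁻¹.map f = (A.map f)⁻¹ := by
  refine (inv_eq_left_inv ?_).symm
  rw [← Matrix.map_mul, nonsing_inv_mul _ hA]
  exact Matrix.map_one _ (map_zero _) (map_one _)

namespace InvariantAlgebra

variable {n : ℕ} {N : Type*} [TopologicalSpace N] {t : OpenPartialHomeomorph N (Fin n → ℂ)}
  (S : InvariantAlgebra n ℂ)

/-- The algebra with the same structure constants over the holomorphic functions. -/
def hol (t : OpenPartialHomeomorph N (Fin n → ℂ)) : InvariantAlgebra n (holFun t) :=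
  S.map (algebraMap ℂ (holFun t))

theorem hol_C_map_derivation (D : Derivation ℂ (holFun t) (holFun t)) (i : Fin n) :
    ((S.hol t).C i).map D = 0 := by
  ext1 a b; exact D.map_algebraMap _

theorem hol_G_map_derivation (D : Derivation ℂ (holFun t) (holFun t)) :
    (S.hol t).G.map D = 0 := by
  ext1 a b; exact D.map_algebraMap _

theorem hol_G_map_evalAt (p : N) : (S.hol t).G.map (evalAt t p) = S.G := rfl

theorem hol_mulMat_map_evalAt (p : N) (T : Fin n → holFun t) :
    ((S.hol t).mulMat T).map (evalAt t p) = S.mulMat fun i => (T i : N → ℂ) p := by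
  rw [map_mulMat]; rfl

end InvariantAlgebra

section Coordinates

variable {n : ℕ} {N : Type*} [TopologicalSpace N] [ChartedSpace (Fin n → ℂ) N]
  {t : OpenPartialHomeomorph N (Fin n → ℂ)}

namespace IsCoordSystem

variable (ht : IsCoordSystem t)
include ht

/-- The matrix of an endomorphism of a tangent space in the basis `(∂_i)`. -/
def endMat (p : N) : Module.End ℂ (Tan n p) ≃ₐ[ℂ] Matrix (Fin n) (Fin n) ℂ :=
  LinearMap.toMatrixAlgEquiv (ht.basis p)

theorem endMat_apply (p : N) (A : Module.End ℂ (Tan n p)) (i j : Fin n) :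
    ht.endMat p A i j = dt t i p (A (coordField t j p)) := by
  rw [endMat, LinearMap.toMatrixAlgEquiv_apply, ht.basis_repr, ht.basis_apply]

theorem sum_dt_smul (p : N) (v : Tan n p) : ∑ i, dt t i p v • coordField t i p = v := by
  have := (ht.basis p).sum_repr v
  simpa only [ht.basis_repr, ht.basis_apply] using this

theorem dt_sum_smul (p : N) (f : Fin n → ℂ) (i : Fin n) :
    dt t i p (∑ j, f j • coordField t j p) = f i := by
  simp [map_sum, ht.dt_coordField]

theorem bilin_apply (g : BilinField n N) (p : N) (u v : Tan n p) :
    g p u v = (fun i => dt t i p u) ⬝ᵥ (gram t g p *ᵥ fun i => dt t i p v) := by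
  conv_lhs => rw [← ht.sum_dt_smul p u, ← ht.sum_dt_smul p v]
  simp only [map_sum, map_smul, LinearMap.sum_apply, LinearMap.smul_apply, smul_eq_mul,
    dotProduct, mulVec, gram, of_apply, Finset.mul_sum]
  rw [Finset.sum_comm]
  exact Finset.sum_congr rfl fun i _ => Finset.sum_congr rfl fun j _ => by ring

theorem gram_isUnit_det {g : BilinField n N}
    (hg : ∀ p u, (∀ v, g p u v = 0) → u = 0) (p : N) : IsUnit (gram t g p).det := by
  rw [isUnit_iff_ne_zero]
  intro h0
  obtain ⟨v, hv, hv0⟩ := exists_vecMul_eq_zero_iff.2 h0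
  refine hv (funext fun i => ?_)
  have h1 : (∑ i, v i • coordField t i p) = 0 := hg p _ fun w => by
    rw [ht.bilin_apply]
    simp only [ht.dt_sum_smul]
    rw [dotProduct_mulVec, hv0, zero_dotProduct]
  rw [← ht.dt_sum_smul p v i, h1, map_zero]; rfl

theorem dt_sharp (ε : BilinField n N) (ψ : OneForm n N) (p : N) (i : Fin n) :
    dt t i p (sharp t ε ψ p) = ∑ j, (gram t ε p)⁻¹ i j * ψ p (coordField t j p) := by
  rw [sharp, ht.dt_sum_smul]

/-- The Lie derivative along a coordinate field differentiates the components. -/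
theorem endMat_lieEnd (A : EndField n N) (j : Fin n) (p : N)
    (a b : Fin n) : ht.endMat p (lieEnd t (coordField t j) A p) a b =
      pd t j (fun q => ht.endMat q (A q) a b) p := by
  have hc : ∀ (i : Fin n) (z : ℂ), pd t i (fun _ => z) p = 0 := fun i z => by simp [pd]
  rw [ht.endMat_apply]
  simp [lieEnd, ht.dt_coordField, hc, ht.endMat_apply, LinearMap.sum_apply]

end IsCoordSystem

end Coordinates

section Algebra

variable {n : ℕ} {N : Type*} [TopologicalSpace N] [ChartedSpace (Fin n → ℂ) N]
  [IsManifold 𝓘(ℂ, Fin n → ℂ) ω N] {F : FManifold n N} {t : OpenPartialHomeomorph N (Fin n → ℂ)}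
  {ε : BilinField n N}

/-- `(ψ ∘ ψ)(X ∘ Y) = ε(T ∘ X, T ∘ Y)` for `T = ε⁻¹(ψ)`. -/
theorem psiMetric_apply (hεF : IsInvariant F ε) (ψ : OneForm n N) (p : N) (u v : Tan n p) :
    psiMetric F t ε ψ p u v =
      ε p (F.mul p (sharp t ε ψ p) u) (F.mul p (sharp t ε ψ p) v) := by
  change ε p (F.mul p (sharp t ε ψ p) (sharp t ε ψ p)) (F.mul p u v) = _
  rw [hεF, hεF, ← F.mul_assoc, F.mul_comm p _ u, F.mul_assoc]

/-- If the 1-form `ψ` is invertible, so is the vector field `T = ε⁻¹(ψ)`. -/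
theorem exists_inverse (hε : IsMetric t ε) {ψ : OneForm n N} (hψi : IsInvertibleForm F t ε ψ)
    (p : N) : ∃ u, F.mul p (sharp t ε ψ p) u = F.e p := by
  obtain ⟨β, hβ⟩ := hψi
  refine ⟨sharp t ε β p, ?_⟩
  rw [← sub_eq_zero]
  refine hε.nondegenerate p _ fun v => ?_
  rw [map_sub, LinearMap.sub_apply, sub_eq_zero]
  exact DFunLike.congr_fun (hβ p) v

theorem psiMetric_nondegenerate (hε : IsMetric t ε) (hεF : IsInvariant F ε) {ψ : OneForm n N}
    (hψi : IsInvertibleForm F t ε ψ) (p : N) (u : Tan n p)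
    (h : ∀ v, psiMetric F t ε ψ p u v = 0) : u = 0 := by
  obtain ⟨w, hw⟩ := exists_inverse hε hψi p
  have h1 : F.mul p (sharp t ε ψ p) u = 0 := hε.nondegenerate p _ fun v => by
    have h2 := h (F.mul p w v)
    rwa [psiMetric_apply hεF, ← F.mul_assoc, hw, F.e_mul] at h2
  rw [← F.e_mul p u, ← hw, F.mul_comm p _ w, F.mul_assoc, h1, map_zero]

theorem psiMetric_isInvariant (ψ : OneForm n N) : IsInvariant F (psiMetric F t ε ψ) :=
  fun p u v w => by
    change ε p _ (F.mul p (F.mul p u v) w) = ε p _ (F.mul p u (F.mul p v w))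
    rw [F.mul_assoc]

/-- The algebra `S` describes the multiplication and the bilinear form `ε` in the coordinates `t`,
at every point. -/
structure IsModel (F : FManifold n N) (t : OpenPartialHomeomorph N (Fin n → ℂ))
    (ε : BilinField n N) (S : InvariantAlgebra n ℂ) : Prop where
  isCoordSystem : IsCoordSystem t
  mul_eq : ∀ p i, isCoordSystem.endMat p (F.mul p (coordField t i p)) = S.C i
  gram_eq : ∀ p, gram t ε p = S.G

/-- A constant F-manifold with a constant invariant metric is described by a single algebra. -/
theorem exists_isModel [Nonempty N] (ht : IsCanonical F t) (hε : IsMetric t ε)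
    (hεF : IsInvariant F ε) (hεc : HasConstCoeffs t ε) : ∃ S, IsModel F t ε S := by
  obtain ⟨c, hc⟩ := ht.mul_const
  obtain ⟨a, ha⟩ := hεc
  obtain ⟨p⟩ := ‹Nonempty N›
  have hcs := ht.isCoordSystem
  have hmul : ∀ p i, hcs.endMat p (F.mul p (coordField t i p)) = Matrix.of fun k j => c i j k := by
    intro p i
    ext k j
    rw [hcs.endMat_apply, hc, hcs.dt_sum_smul, of_apply]
  have haa : ∀ i j, ε p (coordField t i p) (coordField t j p) = a i j := fun i j => by
    rw [← ha p]; rfl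
  refine ⟨⟨fun i => Matrix.of fun k j => c i j k, a, ?_, ?_, ?_, ?_, ?_⟩, hcs, hmul, ha⟩
  · intro i j k
    simp only [of_apply]
    rw [← hcs.dt_sum_smul p (c i j), ← hcs.dt_sum_smul p (c j i), ← hc, ← hc, F.mul_comm]
  · intro i j
    have h1 : F.mul p (coordField t i p) * F.mul p (coordField t j p) =
        ∑ k, c i j k • F.mul p (coordField t k p) := by
      ext1 v
      rw [Module.End.mul_apply, ← F.mul_assoc, hc]
      simp [map_sum, LinearMap.sum_apply]
    rw [← hmul p i, ← hmul p j, ← map_mul, h1, map_sum]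
    simp only [map_smul, hmul, of_apply]
  · ext i j
    rw [transpose_apply, ← haa, ← haa, hε.symm]
  · rw [← ha p]; exact hcs.gram_isUnit_det hε.nondegenerate p
  · intro i
    ext j l
    have h1 := hεF p (coordField t j p) (coordField t i p) (coordField t l p)
    rw [F.mul_comm, hc, hc] at h1
    simp only [map_sum, map_smul, LinearMap.sum_apply, LinearMap.smul_apply, haa,
      smul_eq_mul] at h1
    simp only [mul_apply, of_apply, transpose_apply, h1]
    exact Finset.sum_congr rfl fun k _ => mul_comm _ _

namespace IsModel

variable {S : InvariantAlgebra n ℂ} (hS : IsModel F t ε S)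
include hS

theorem endMat_mul (p : N) (v : Tan n p) :
    hS.isCoordSystem.endMat p (F.mul p v) = S.mulMat fun i => dt t i p v := by
  conv_lhs => rw [← hS.isCoordSystem.sum_dt_smul p v]
  simp only [map_sum, map_smul, hS.mul_eq, S.mulMat_def]

theorem dt_mul (p : N) (u v : Tan n p) (i : Fin n) : dt t i p (F.mul p u v) =
    (S.mulMat (fun i => dt t i p u) *ᵥ fun i => dt t i p v) i := by
  conv_lhs => rw [← hS.isCoordSystem.sum_dt_smul p v]
  simp only [← hS.endMat_mul, mulVec, dotProduct, hS.isCoordSystem.endMat_apply, map_sum, map_smul,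
    smul_eq_mul, mul_comm]

theorem mulMat_unit (p : N) : S.mulMat (fun i => dt t i p (F.e p)) = 1 := by
  rw [← hS.endMat_mul, ← map_one (hS.isCoordSystem.endMat p)]
  congr 1
  ext1 v
  exact F.e_mul p v

/-- The unit field has constant coordinates, since an algebra has only one unit. -/
theorem unit_const (p q : N) (i : Fin n) : dt t i p (F.e p) = dt t i q (F.e q) := by
  have h := S.mulMat_mulVec_comm (fun i => dt t i p (F.e p)) fun i => dt t i q (F.e q)
  rw [hS.mulMat_unit, hS.mulMat_unit, one_mulVec, one_mulVec] at h
  exact (congrFun h i).symm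

theorem dt_sharp_eq (ψ : OneForm n N) (p : N) :
    (fun i => dt t i p (sharp t ε ψ p)) = S.G⁻¹ *ᵥ fun j => ψ p (coordField t j p) := by
  ext i; rw [hS.isCoordSystem.dt_sharp, hS.gram_eq]; rfl

/-- The components of `ψ` are those of `ε(T, ·)`. -/
theorem form_coordField (ψ : OneForm n N) (p : N) :
    (fun j => ψ p (coordField t j p)) = S.G *ᵥ fun i => dt t i p (sharp t ε ψ p) := by
  rw [hS.dt_sharp_eq, mulVec_mulVec, mul_nonsing_inv _ S.isUnit_det, one_mulVec]

theorem formMetric_eq (ψ : OneForm n N) (p : N) : formMetric t ε ψ ψ p =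
    (fun i => dt t i p (sharp t ε ψ p)) ⬝ᵥ (S.G *ᵥ fun i => dt t i p (sharp t ε ψ p)) := by
  rw [← hS.form_coordField]
  simp only [formMetric, dotProduct, hS.isCoordSystem.dt_sharp, Finset.sum_mul]
  exact Finset.sum_congr rfl fun i _ => Finset.sum_congr rfl fun j _ => by ring

theorem mulMat_mul_mulMat_eq_one (p : N) {u v : Tan n p} (h : F.mul p u v = F.e p) :
    S.mulMat (fun i => dt t i p u) * S.mulMat (fun i => dt t i p v) = 1 := by
  rw [S.mulMat_mul_mulMat, ← hS.mulMat_unit p, ← h]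
  congr 1
  exact funext fun i => (hS.dt_mul p u v i).symm

/-- The coordinates of `T = ε⁻¹(ψ)`, as holomorphic functions. -/
def vec {ψ : OneForm n N} (hψ : HolForm t ψ) (i : Fin n) : holFun t :=
  ⟨fun p => dt t i p (sharp t ε ψ p), by
    have h : (fun p => dt t i p (sharp t ε ψ p)) =
        ∑ j, S.G⁻¹ i j • fun p => ψ p (coordField t j p) := by
      ext p
      rw [congrFun (hS.dt_sharp_eq ψ p) i, Finset.sum_apply]
      rfl
    rw [h]
    exact Subalgebra.sum_mem _ fun j _ => Subalgebra.smul_mem _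
      ((hS.isCoordSystem.mdifferentiable_iff _).1 (hψ j)) _⟩

variable {ψ : OneForm n N} (hψ : HolForm t ψ)

@[simp]
theorem coe_vec (i : Fin n) (p : N) :
    (hS.vec hψ i : N → ℂ) p = dt t i p (sharp t ε ψ p) := rfl

theorem gram_psiMetric (hεF : IsInvariant F ε) (p : N) :
    gram t (psiMetric F t ε ψ) p = ((S.hol t).twist (hS.vec hψ)).map (evalAt t p) := by
  have h1 : ∀ i, (fun k => dt t k p (F.mul p (sharp t ε ψ p) (coordField t i p))) =
      S.mulMat (fun i => dt t i p (sharp t ε ψ p)) *ᵥ Pi.single i 1 := fun i => by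
    ext k
    rw [hS.dt_mul]
    congr 2
    ext l
    rw [hS.isCoordSystem.dt_coordField, Pi.single_apply]
    simp only [eq_comm]
  rw [InvariantAlgebra.twist, Matrix.map_mul, Matrix.map_mul, S.hol_G_map_evalAt,
    S.hol_mulMat_map_evalAt, S.G_mul_mulMat]
  ext i j
  rw [gram, of_apply, psiMetric_apply hεF, hS.isCoordSystem.bilin_apply, h1, h1, hS.gram_eq,
    mulVec_single_one, mulVec_mulVec, mulVec_single_one, mul_assoc, mul_apply]
  rfl

theorem isUnit_mulMat (hε : IsMetric t ε) (hψi : IsInvertibleForm F t ε ψ) :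
    IsUnit ((S.hol t).mulMat (hS.vec hψ)).det := by
  refine holFun.isUnit_of_ne_zero _ fun p h0 => ?_
  obtain ⟨w, hw⟩ := exists_inverse hε hψi p
  have h1 := congrArg det (hS.mulMat_mul_mulMat_eq_one p hw)
  have h2 : evalAt t p ((S.hol t).mulMat (hS.vec hψ)).det = 0 := h0
  rw [RingHom.map_det, RingHom.mapMatrix_apply, S.hol_mulMat_map_evalAt] at h2
  simp only [coe_vec] at h2
  rw [det_mul, h2, zero_mul, det_one] at h1
  exact zero_ne_one h1

include hψ in
theorem psiMetric_isMetric (hε : IsMetric t ε) (hεF : IsInvariant F ε)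
    (hψi : IsInvertibleForm F t ε ψ) : IsMetric t (psiMetric F t ε ψ) where
  symm p u v := by
    rw [psiMetric_apply hεF, psiMetric_apply hεF, hε.symm]
  nondegenerate p u h := psiMetric_nondegenerate hε hεF hψi p u h
  holomorphic i j := by
    rw [hS.isCoordSystem.mdifferentiable_iff]
    simp only [hS.gram_psiMetric hψ hεF]
    exact ((S.hol t).twist (hS.vec hψ) i j).2

/-- The endomorphism `γ` has matrix `M⁻¹ G⁻¹ Jᵀ G`. -/
theorem endMat_rotationOp (hε : IsMetric t ε) (hψi : IsInvertibleForm F t ε ψ) (p : N) :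
    hS.isCoordSystem.endMat p (rotationOp F t ε ψ p) =
      ((S.hol t).rotation hS.isCoordSystem.pdDer (hS.vec hψ)).map (evalAt t p) := by
  have ht := hS.isCoordSystem
  set M := (S.hol t).mulMat (hS.vec hψ) with hM
  have hMu := hS.isUnit_mulMat hψ hε hψi
  -- the inverse of `T` is represented by the inverse matrix
  have hinv : S.mulMat (fun i => dt t i p (vinv F (sharp t ε ψ) p)) =
      M⁻¹.map (evalAt t p) := by
    have hex := exists_inverse hε hψi p
    have h1 : F.mul p (sharp t ε ψ p) (vinv F (sharp t ε ψ) p) = F.e p := by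
      rw [vinv, dif_pos hex]; exact hex.choose_spec
    have h2 := hS.mulMat_mul_mulMat_eq_one p h1
    have h3 : M⁻¹.map (evalAt t p) * S.mulMat (fun i => dt t i p (sharp t ε ψ p)) = 1 := by
      have := S.hol_mulMat_map_evalAt p (hS.vec hψ)
      simp only [coe_vec] at this
      rw [← this, ← Matrix.map_mul, nonsing_inv_mul _ hMu]
      exact Matrix.map_one _ (map_zero _) (map_one _)
    exact (left_inv_eq_right_inv h3 h2).symm
  -- the fields `ε⁻¹(dtⁱ)` are constant, which leaves only the derivatives of `ψ`
  -- in the components of the Lie derivatives of `ψ`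
  have hlie : ∀ i b, lieForm t (sharp t ε (dt t i)) ψ p (coordField t b p) =
      ∑ k, S.G⁻¹ k i * pd t k (fun q => ψ q (coordField t b q)) p := by
    intro i b
    have hX : ∀ q k, dt t k q (sharp t ε (dt t i) q) = S.G⁻¹ k i := by
      intro q k
      rw [ht.dt_sharp, hS.gram_eq]
      simp [ht.dt_coordField]
    have hc : ∀ j k, pd t j (fun _ => S.G⁻¹ k i) p = 0 := by
      intro j k; simp [pd]
    simp [lieForm, hX, hc, ht.dt_coordField]
  have hpd : ∀ b k, pd t k (fun q => ψ q (coordField t b q)) p =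
      ∑ m, S.G b m * pd t k (hS.vec hψ m) p := by
    intro b k
    have h1 : (fun q => ψ q (coordField t b q)) =
        ((∑ m, algebraMap ℂ (holFun t) (S.G b m) * hS.vec hψ m : holFun t) : N → ℂ) := by
      ext q
      have := congrFun (hS.form_coordField ψ q) b
      change _ = evalAt t q _
      rw [this, map_sum]
      simp [mulVec, dotProduct]
    rw [h1, ← ht.coe_pdDer, ← evalAt_apply]
    simp [map_sum, Derivation.leibniz]
  ext a b
  have hGs : ∀ i k, S.G⁻¹ i k = S.G⁻¹ k i := fun i k => by
    rw [← transpose_apply S.G⁻¹, transpose_nonsing_inv, S.symm]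
  have hGs' : ∀ i k, S.G i k = S.G k i := fun i k => by rw [← transpose_apply S.G, S.symm]
  have hdt : ∀ i, dt t a p (F.mul p (coordField t i p) (vinv F (sharp t ε ψ) p)) =
      M⁻¹.map (evalAt t p) a i := fun i => by
    rw [F.mul_comm, ← ht.endMat_apply, hS.endMat_mul, hinv]
  rw [ht.endMat_apply, rotationOp, InvariantAlgebra.rotation, Matrix.map_mul, Matrix.map_mul,
    Matrix.map_mul, map_nonsing_inv _ _ (S.hol t).isUnit_det, S.hol_G_map_evalAt, ← hM, mul_assoc,
    mul_assoc, mul_apply, LinearMap.sum_apply, map_sum]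
  refine Finset.sum_congr rfl fun i _ => ?_
  rw [LinearMap.smulRight_apply, map_smul, hdt, smul_eq_mul, mul_comm, hlie, mul_apply]
  congr 1
  refine Finset.sum_congr rfl fun k _ => ?_
  rw [hGs, hpd, mul_apply]
  congr 1
  refine Finset.sum_congr rfl fun m _ => ?_
  rw [hGs', mul_comm]
  rfl

end IsModel

end Algebra

/-! ### The Frobenius conditions -/

section HolomorphicFunctions

variable {n : ℕ} {N : Type*} [TopologicalSpace N] {t : OpenPartialHomeomorph N (Fin n → ℂ)}

theorem matrix_eq_iff_evalAt (A B : Matrix (Fin n) (Fin n) (holFun t)) :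
    A = B ↔ ∀ p, (evalAt t p).mapMatrix A = (evalAt t p).mapMatrix B := by
  refine ⟨fun h p => by rw [h], fun h => ?_⟩
  ext i j p
  exact congrFun (congrFun (h p) i) j

end HolomorphicFunctions

section Characterization

variable {n : ℕ} {N : Type*} [TopologicalSpace N] [ChartedSpace (Fin n → ℂ) N]
  [IsManifold 𝓘(ℂ, Fin n → ℂ) ω N] {F : FManifold n N} {t : OpenPartialHomeomorph N (Fin n → ℂ)}
  {ε : BilinField n N}

namespace IsModel

variable {S : InvariantAlgebra n ℂ} (hS : IsModel F t ε S) {ψ : OneForm n N} (hψ : HolForm t ψ)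
include hS

/-- The matrix of `γ`, with holomorphic entries. -/
def gammaMat : Matrix (Fin n) (Fin n) (holFun t) :=
  (S.hol t).rotation hS.isCoordSystem.pdDer (hS.vec hψ)

theorem isSymmEnd_iff (hε : IsMetric t ε) (hψi : IsInvertibleForm F t ε ψ) :
    IsSymmEnd ε (rotationOp F t ε ψ) ↔
      (S.hol t).G * hS.gammaMat hψ = (hS.gammaMat hψ)ᵀ * (S.hol t).G := by
  have ht := hS.isCoordSystem
  have hγ : ∀ p b a, dt t a p (rotationOp F t ε ψ p (coordField t b p)) =
      (evalAt t p).mapMatrix (hS.gammaMat hψ) a b := fun p b a => by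
    rw [← ht.endMat_apply, hS.endMat_rotationOp hψ hε hψi]; rfl
  have hγv : ∀ p v, (fun a => dt t a p (rotationOp F t ε ψ p v)) =
      (evalAt t p).mapMatrix (hS.gammaMat hψ) *ᵥ fun b => dt t b p v := fun p v => by
    ext a
    conv_lhs => rw [← ht.sum_dt_smul p v]
    simp only [map_sum, map_smul, hγ, mulVec, dotProduct, smul_eq_mul, mul_comm]
  have hG : ∀ p, (evalAt t p).mapMatrix (S.hol t).G = S.G := fun p => rfl
  have htr : ∀ p, (evalAt t p).mapMatrix (hS.gammaMat hψ)ᵀ =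
      ((evalAt t p).mapMatrix (hS.gammaMat hψ))ᵀ := fun p => rfl
  rw [matrix_eq_iff_evalAt]
  simp only [map_mul, hG, htr]
  refine forall_congr' fun p => ?_
  simp only [ht.bilin_apply, hS.gram_eq, hγv]
  constructor
  · intro h
    ext i j
    have h1 := h (coordField t i p) (coordField t j p)
    have hs : ∀ j : Fin n, (fun i => dt t i p (coordField t j p)) = Pi.single j 1 := fun j => by
      ext i; rw [ht.dt_coordField, Pi.single_apply]; simp only [eq_comm]
    rw [hs, hs, mulVec_mulVec, mulVec_single_one, mulVec_single_one, mulVec_single_one,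
      single_one_dotProduct] at h1
    exact h1.symm
  · intro h u v
    rw [mulVec_mulVec, h, ← mulVec_mulVec, dotProduct_mulVec _ (_)ᵀ, vecMul_transpose]

theorem darbouxEgoroff_iff (hε : IsMetric t ε) (hψi : IsInvertibleForm F t ε ψ) :
    DarbouxEgoroff F t (rotationOp F t ε ψ) ↔ ∀ i j,
      ⁅(S.hol t).C i, (hS.gammaMat hψ).map (hS.isCoordSystem.pdDer j)⁆
        - ⁅(S.hol t).C j, (hS.gammaMat hψ).map (hS.isCoordSystem.pdDer i)⁆
        = ⁅⁅(S.hol t).C i, hS.gammaMat hψ⁆, ⁅(S.hol t).C j, hS.gammaMat hψ⁆⁆ := by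
  have ht := hS.isCoordSystem
  have hγ : ∀ p, ht.endMat p (rotationOp F t ε ψ p) =
      (evalAt t p).mapMatrix (hS.gammaMat hψ) := fun p => hS.endMat_rotationOp hψ hε hψi p
  have hC : ∀ p i, ht.endMat p (multOp F t i p) = (evalAt t p).mapMatrix ((S.hol t).C i) :=
    fun p i => hS.mul_eq p i
  have hL : ∀ p j, ht.endMat p (lieEnd t (coordField t j) (rotationOp F t ε ψ) p) =
      (evalAt t p).mapMatrix ((hS.gammaMat hψ).map (hS.isCoordSystem.pdDer j)) := by
    intro p j
    ext a b
    rw [ht.endMat_lieEnd]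
    simp only [hγ]
    rfl
  have key : ∀ p i j, ⁅multOp F t i p, lieEnd t (coordField t j) (rotationOp F t ε ψ) p⁆
      - ⁅multOp F t j p, lieEnd t (coordField t i) (rotationOp F t ε ψ) p⁆
      = ⁅⁅multOp F t i p, rotationOp F t ε ψ p⁆, ⁅multOp F t j p, rotationOp F t ε ψ p⁆⁆ ↔
      (evalAt t p).mapMatrix
        (⁅(S.hol t).C i, (hS.gammaMat hψ).map (hS.isCoordSystem.pdDer j)⁆
        - ⁅(S.hol t).C j, (hS.gammaMat hψ).map (hS.isCoordSystem.pdDer i)⁆)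
      = (evalAt t p).mapMatrix
        ⁅⁅(S.hol t).C i, hS.gammaMat hψ⁆, ⁅(S.hol t).C j, hS.gammaMat hψ⁆⁆ := by
    intro p i j
    rw [← (ht.endMat p).injective.eq_iff]
    simp only [Ring.lie_def, map_sub, map_mul, hγ, hC, hL]
  simp only [DarbouxEgoroff, key, matrix_eq_iff_evalAt]
  exact ⟨fun h i j p => h p i j, fun h p i j => h i j p⟩

theorem pd_gram_psiMetric (hεF : IsInvariant F ε) (i a b : Fin n) (p : N) :
    pd t i (fun q => gram t (psiMetric F t ε ψ) q a b) p =
      (hS.isCoordSystem.pdDer i ((S.hol t).twist (hS.vec hψ) a b) : N → ℂ) p := by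
  simp only [hS.gram_psiMetric hψ hεF]
  rfl

theorem formMetric_eq_coe : formMetric t ε ψ ψ =
    (hS.vec hψ ⬝ᵥ ((S.hol t).G *ᵥ hS.vec hψ) : holFun t) := by
  ext p
  rw [hS.formMetric_eq, ← evalAt_apply]
  simp only [dotProduct, mulVec, map_sum, map_mul]
  rfl

include hψ in
/-- The unit field is parallel for the Levi-Civita connection of `psiMetric` if and only if
`ε (ψ, ψ)` is constant and `γ` is symmetric. -/
theorem unit_flat_iff [Nonempty N] [PreconnectedSpace N] (hε : IsMetric t ε)
    (hεF : IsInvariant F ε) (hψi : IsInvertibleForm F t ε ψ) :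
    (∀ p i k, pd t i (fun q => dt t k q (F.e q)) p
      + ∑ j, christoffel t (psiMetric F t ε ψ) k i j p * dt t j p (F.e p) = 0) ↔
      (∃ c : ℂ, ∀ p, formMetric t ε ψ ψ p = c) ∧ IsSymmEnd ε (rotationOp F t ε ψ) := by
  have ht := hS.isCoordSystem
  obtain ⟨p₀⟩ := ‹Nonempty N›
  set e : Fin n → holFun t := fun i => algebraMap ℂ (holFun t) (dt t i p₀ (F.e p₀)) with he
  have he1 : (S.hol t).mulMat e = 1 := by
    rw [InvariantAlgebra.hol, he, ← S.map_mulMat, hS.mulMat_unit]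
    exact Matrix.map_one _ (map_zero _) (map_one _)
  have h2 : IsUnit (2 : holFun t) := by
    have := (isUnit_iff_ne_zero.2 (two_ne_zero : (2 : ℂ) ≠ 0)).map (algebraMap ℂ (holFun t))
    rwa [map_ofNat] at this
  rw [hS.isSymmEnd_iff hψ hε hψi, gammaMat,
    (S.hol t).rotation_symm_iff _ _ (hS.isUnit_mulMat hψ hε hψi), hS.formMetric_eq_coe hψ,
    ht.exists_eq_const_iff, and_comm, ← (S.hol t).koszul_unit_iff ht.pdDer (hS.vec hψ)
      (fun j => S.hol_C_map_derivation (ht.pdDer j)) (fun j => S.hol_G_map_derivation (ht.pdDer j))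
      h2 e he1 (fun i j => (ht.pdDer i).map_algebraMap _)]
  -- both sides express the vanishing of `V i p`, up to raising an index
  set V : Fin n → N → Fin n → ℂ := fun i p l => ((∑ j, e j *
    (ht.pdDer i ((S.hol t).twist (hS.vec hψ) j l) + ht.pdDer j ((S.hol t).twist (hS.vec hψ) i l)
      - ht.pdDer l ((S.hol t).twist (hS.vec hψ) i j)) : holFun t) : N → ℂ) p with hV
  have hchr : ∀ p i k, pd t i (fun q => dt t k q (F.e q)) p
      + ∑ j, christoffel t (psiMetric F t ε ψ) k i j p * dt t j p (F.e p) =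
      ((gram t (psiMetric F t ε ψ) p)⁻¹ *ᵥ V i p) k / 2 := by
    intro p i k
    have h0 : pd t i (fun q => dt t k q (F.e q)) p = 0 := by
      have : (fun q => dt t k q (F.e q)) = fun _ => dt t k p (F.e p) :=
        funext fun q => hS.unit_const q p k
      rw [this]; simp [pd]
    have hVl : ∀ l, V i p l = ∑ j, dt t j p (F.e p) *
        ((ht.pdDer i ((S.hol t).twist (hS.vec hψ) j l) : N → ℂ) p
        + (ht.pdDer j ((S.hol t).twist (hS.vec hψ) i l) : N → ℂ) p
        - (ht.pdDer l ((S.hol t).twist (hS.vec hψ) i j) : N → ℂ) p) := by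
      intro l
      rw [hV]
      simp only [← evalAt_apply, map_sum, map_mul, map_sub, map_add]
      refine Finset.sum_congr rfl fun j _ => ?_
      congr 1
      exact hS.unit_const p₀ p j
    rw [h0, zero_add]
    simp only [christoffel, hS.pd_gram_psiMetric hψ hεF, mulVec, dotProduct, hVl, Finset.mul_sum,
      Finset.sum_mul, Finset.sum_div]
    rw [Finset.sum_comm]
    exact Finset.sum_congr rfl fun l _ => Finset.sum_congr rfl fun j _ => by ring
  simp only [hchr]
  have hdet : ∀ p, IsUnit (gram t (psiMetric F t ε ψ) p).det := fun p =>
    ht.gram_isUnit_det (psiMetric_nondegenerate hε hεF hψi) p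
  constructor
  · intro h i l
    ext p
    have h1 : (gram t (psiMetric F t ε ψ) p)⁻¹ *ᵥ V i p = 0 := by
      ext k
      simpa using h p i k
    have h3 : V i p = 0 := by
      rw [← one_mulVec (V i p), ← mul_nonsing_inv _ (hdet p), ← mulVec_mulVec, h1, mulVec_zero]
    exact congrFun h3 l
  · intro h p i k
    have h3 : V i p = 0 := funext fun l => congrFun (congrArg (fun f : holFun t => (f : N → ℂ))
      (h i l)) p
    rw [h3, mulVec_zero]
    simp

/-- If `γ` is symmetric, the Christoffel symbols of `psiMetric` are the entries of the matrices
`M⁻¹ (∂_j M + [C_j, γ] M)`. -/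
theorem christoffel_psiMetric (hε : IsMetric t ε) (hεF : IsInvariant F ε)
    (hψi : IsInvertibleForm F t ε ψ)
    (hγ : (S.hol t).G * hS.gammaMat hψ = (hS.gammaMat hψ)ᵀ * (S.hol t).G) (k i j : Fin n) :
    christoffel t (psiMetric F t ε ψ) k i j =
      ((S.hol t).connection hS.isCoordSystem.pdDer (hS.vec hψ) i k j : N → ℂ) := by
  ext p
  have ht := hS.isCoordSystem
  have hu := hS.isUnit_mulMat hψ hε hψi
  have hC := fun j => S.hol_C_map_derivation (ht.pdDer j)
  have hG := fun j => S.hol_G_map_derivation (ht.pdDer j)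
  refine koszul_unique (gram t (psiMetric F t ε ψ) p)
    (ht.gram_isUnit_det (psiMetric_nondegenerate hε hεF hψi) p)
    (fun i a b => pd t i (fun q => gram t (psiMetric F t ε ψ) q a b) p)
    (fun k i j => ((S.hol t).connection ht.pdDer (hS.vec hψ) i k j : N → ℂ) p) ?_ ?_ k i j
  · intro a i j
    rw [(S.hol t).connection_torsion_free ht.pdDer (hS.vec hψ) hu hC hγ]
  · intro i a b
    have h1 := congrFun (congrFun
      ((S.hol t).map_derivation_twist ht.pdDer (hS.vec hψ) hu hC hG hγ i) a) b
    have h2 := congrArg (evalAt t p) h1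
    have hg : ∀ a b, gram t (psiMetric F t ε ψ) p a b =
        evalAt t p ((S.hol t).twist (hS.vec hψ) a b) := fun a b => by
      rw [hS.gram_psiMetric hψ hεF]; rfl
    rw [hS.pd_gram_psiMetric hψ hεF]
    simp only [Matrix.map_apply, Matrix.add_apply, transpose_apply, mul_apply, map_add, map_sum,
      map_mul] at h2
    simp only [hg]
    exact h2

include hψ in
/-- For symmetric `γ`, the metric `psiMetric` is flat if and only if the Darboux-Egoroff equations
hold. -/
theorem flat_iff (hε : IsMetric t ε) (hεF : IsInvariant F ε) (hψi : IsInvertibleForm F t ε ψ)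
    (hsymm : IsSymmEnd ε (rotationOp F t ε ψ)) :
    (∀ p l k i j, curvature t (psiMetric F t ε ψ) l k i j p = 0) ↔
      DarbouxEgoroff F t (rotationOp F t ε ψ) := by
  have ht := hS.isCoordSystem
  rw [hS.isSymmEnd_iff hψ hε hψi] at hsymm
  rw [hS.darbouxEgoroff_iff hψ hε hψi]
  have key := (S.hol t).curvature_eq_zero_iff ht.pdDer (hS.vec hψ) (hS.isUnit_mulMat hψ hε hψi)
    (fun j => S.hol_C_map_derivation (ht.pdDer j)) ht.pdDer_comm
  simp only [gammaMat, ← key]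
  have hcurv : ∀ p l k i j, curvature t (psiMetric F t ε ψ) l k i j p =
      evalAt t p ((((S.hol t).connection ht.pdDer (hS.vec hψ) j).map (ht.pdDer i)
        - ((S.hol t).connection ht.pdDer (hS.vec hψ) i).map (ht.pdDer j)
        + ((S.hol t).connection ht.pdDer (hS.vec hψ) i * (S.hol t).connection ht.pdDer (hS.vec hψ) j
        - (S.hol t).connection ht.pdDer (hS.vec hψ) j
          * (S.hol t).connection ht.pdDer (hS.vec hψ) i)) l k) := by
    intro p l k i j
    simp only [curvature, hS.christoffel_psiMetric hψ hε hεF hψi hsymm, Matrix.add_apply,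
      Matrix.sub_apply, mul_apply, Matrix.map_apply, map_add, map_sub, map_sum, map_mul,
      Finset.sum_sub_distrib]
    rfl
  simp only [hcurv]
  constructor
  · intro h i j
    ext l k p
    exact h p l k i j
  · intro h p l k i j
    rw [h i j]
    rfl

end IsModel

end Characterization

end ConstantFManifold

end

open ConstantFManifold in
theorem mainTheorem7 {n : ℕ} {N : Type*} [TopologicalSpace N] [ChartedSpace (Fin n → ℂ) N]
    [IsManifold 𝓘(ℂ, Fin n → ℂ) ω N] [PreconnectedSpace N]
    (F : FManifold n N) (t : OpenPartialHomeomorph N (Fin n → ℂ)) (ht : IsCanonical F t)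
    (ε : BilinField n N) (hε : IsMetric t ε) (hεF : IsInvariant F ε) (hεc : HasConstCoeffs t ε)
    (ψ : OneForm n N) (hψ : HolForm t ψ) (hψi : IsInvertibleForm F t ε ψ) :
    IsFrobenius F t (psiMetric F t ε ψ) ↔
      (∃ c : ℂ, ∀ p, formMetric t ε ψ ψ p = c) ∧
      IsSymmEnd ε (rotationOp F t ε ψ) ∧
      DarbouxEgoroff F t (rotationOp F t ε ψ) := by
  -- without points there is no algebra to compare with, and both sides are void
  rcases isEmpty_or_nonempty N with hN | hN
  · exact ⟨fun _ => ⟨⟨0, isEmptyElim⟩, isEmptyElim, isEmptyElim⟩, fun _ =>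
      ⟨⟨isEmptyElim, isEmptyElim, fun _ _ => isEmptyElim⟩, isEmptyElim, isEmptyElim, isEmptyElim⟩⟩
  obtain ⟨S, hS⟩ := exists_isModel ht hε hεF hεc
  have hunit := hS.unit_flat_iff hψ hε hεF hψi
  constructor
  · intro h
    obtain ⟨hc, hs⟩ := hunit.1 h.unit_flat
    exact ⟨hc, hs, (hS.flat_iff hψ hε hεF hψi hs).1 h.flat⟩
  · rintro ⟨hc, hs, hDE⟩
    exact ⟨hS.psiMetric_isMetric hψ hε hεF hψi, psiMetric_isInvariant ψ,
      (hS.flat_iff hψ hε hεF hψi hs).2 hDE, hunit.2 ⟨hc, hs⟩⟩
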